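/- Let $\mathcal T$ be the category of compactly generated spaces with nondegenerate basepoint and let $F:\mathcal T\to\mathcal T$ be a continuous functor, i.e. $\mathrm{Map}(Y,Z)\to \mathrm{Map}(FY,FZ)$ is continuous for all $Y,Z$. Fix $X\in\mathcal T$ and $n\ge 0$, and write $F_X(-)=F(X\wedge -)$. For a continuous functor $G$ on $\mathcal T$: - $LG$ denotes the homotopy left Kan extension of $G$ along the inclusion of the category $\mathcal S$ of the finite pointed sets $[k]=\{0,\dots,k\}$ into $\mathcal T$: $LG(Y)$ is the thick geometric realization of the simplicial space $$[k]\longmapsto \bigvee_{(C_0,\dots,C_k)} G(C_0)\wedge\bigl(\mathcal S(C_0,C_1)\times\cdots\times \mathcal S(C_{k-1},C_k)\times \mathrm{Map}(C_k,Y)\bigr)_+ ,$$ and $LG(Y)\to G(Y)$ is the natural map induced by $x\wedge f\mapsto G(f)(x)$. - $T_nG(Y)=\operatorname{holim}_{\emptyset\ne U\subseteq\{0,\dots,n\}}G(U*Y)$, where $U*Y$ is the reduced join (the mapping cone of the fold map $\bigvee_U Y\to Y$), and Goodwillie's approximation is $P_nG=\operatorname{hocolim}(G\to T_nG\to T_nT_nG\to\cdots)$.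 The same definition is used for functors, such as $LG$, whose values are pointed compactly generated spaces. The algebraic Goodwillie approximation is $P_n^{\mathrm{alg}}F(X)=P_n(LF_X)(S^0)$. The natural map $P_n^{\mathrm{alg}}F(X)\to P_nF(X)$ is the map $P_n(LF_X)(S^0)\to P_n(F_X)(S^0)$ induced by $LF_X\to F_X$, followed by the canonical identification $P_n(F_X)(S^0)\cong P_nF(X\wedge S^0)\cong P_nF(X)$. **Proposition.** If $F_X$ commutes with realizations, that is, the natural map $LF_X(Y)\to F_X(Y)$ is a weak homotopy equivalence for every $Y\in\mathcal T$, then the natural map $P_n^{\mathrm{alg}}F(X)\to P_nF(X)$ is a weak homotopy equivalence. -/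

import Mathlib

open CategoryTheory Topology
open scoped unitInterval

universe u v

namespace AlgGoodwillie

/-! ## Compactly generated spaces -/

section Kify

/-- The compactly generated refinement (`k`-ification) of a topological space. -/
def Kify (X : Type u) [TopologicalSpace X] : Type u := X

/-- The identity `X → Kify X`. -/
def toK {X : Type u} [TopologicalSpace X] (x : X) : Kify X := x

/-- The identity `Kify X → X`. -/
def ofK {X : Type u} [TopologicalSpace X] (x : Kify X) : X := x

variable {X Y Z : Type u} [TopologicalSpace X] [TopologicalSpace Y] [TopologicalSpace Z]

@[simp] lemma ofK_toK (x : X) : ofK (toK x) = x := rfl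
@[simp] lemma toK_ofK (x : Kify X) : toK (ofK x) = x := rfl

instance : TopologicalSpace (Kify X) := TopologicalSpace.compactlyGenerated.{u} X

lemma continuous_toK_of_compact {K : Type u} [TopologicalSpace K] [CompactSpace K] [T2Space K]
    {g : K → X} (hg : Continuous g) : Continuous (fun k => toK (g k)) := by
  let f : (Σ (i : (S : CompHaus.{u}) × C(S, X)), i.fst) → X := fun ⟨⟨_, i⟩, s⟩ ↦ i s
  have h1 : Continuous (fun p => toK (f p)) := continuous_coinduced_rng
  have h2 : Continuous (fun k => (⟨⟨CompHaus.of K, ⟨g, hg⟩⟩, k⟩ :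
      Σ (i : (S : CompHaus.{u}) × C(S, X)), i.fst)) :=
    @continuous_sigmaMk _ (fun i : (S : CompHaus.{u}) × C(S, X) => (i.fst : Type u)) _
      ⟨CompHaus.of K, ⟨g, hg⟩⟩
  exact h1.comp h2

@[fun_prop]
lemma continuous_ofK : Continuous (ofK : Kify X → X) :=
  continuous_from_compactlyGenerated.{u} (fun x : X => x) fun _ g => g.2

lemma continuous_Kify_dom {g : Kify X → Z}
    (h : ∀ (K : Type u) [TopologicalSpace K] [CompactSpace K] [T2Space K] (f : K → X),
      Continuous f → Continuous (fun k => g (toK (f k)))) : Continuous g :=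
  continuous_from_compactlyGenerated.{u} (X := X) g fun S f => h S f f.2

instance : CompactlyGeneratedSpace (Kify X) :=
  compactlyGeneratedSpace_of_continuous_maps fun _ h =>
    continuous_Kify_dom fun K _ _ _ g hg => h K (fun k => toK (g k)) (continuous_toK_of_compact hg)

lemma continuous_toK [CompactlyGeneratedSpace Y] {g : Y → X} (hg : Continuous g) :
    Continuous (fun y => toK (g y)) :=
  continuous_from_compactlyGeneratedSpace (X := Y) (fun y => toK (g y)) fun _ _ _ _ f hf =>
    continuous_toK_of_compact (g := fun k => g (f k)) (hg.comp hf)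

lemma continuous_Kify_map {g : X → Y} (hg : Continuous g) :
    Continuous (fun x : Kify X => toK (g (ofK x))) :=
  continuous_toK (hg.comp continuous_ofK)

/-- A compactly generated space times a compact Hausdorff space is compactly generated. -/
instance instCGProd {L : Type} [TopologicalSpace L] [CompactSpace L] [T2Space L]
    [CompactlyGeneratedSpace X] : CompactlyGeneratedSpace (X × L) := by
  refine compactlyGeneratedSpace_of_continuous_maps fun {W} _ f h => ?_
  have h' : ∀ (K : Type u) [TopologicalSpace K] [CompactSpace K] [T2Space K] (g : K → X),
      Continuous g → Continuous (fun p : K × L => f (g p.1, p.2)) := fun K _ _ _ g hg =>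
    h (K × L) (fun p => (g p.1, p.2)) (by fun_prop)
  have hx : ∀ x, Continuous fun l => f (x, l) := fun x =>
    (h' PUnit (fun _ => x) continuous_const).comp (by fun_prop : Continuous fun l => (PUnit.unit, l))
  let G : X → C(L, W) := fun x => ⟨_, hx x⟩
  have hG : Continuous G := continuous_from_compactlyGeneratedSpace _ fun K _ _ _ g hg =>
    (ContinuousMap.curry ⟨_, h' K g hg⟩).continuous
  exact ContinuousMap.continuous_uncurry_of_continuous ⟨G, hG⟩

instance instCGProd' {L : Type u} [TopologicalSpace L] [CompactSpace L] [T2Space L]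
    [CompactlyGeneratedSpace X] : CompactlyGeneratedSpace (L × X) := by
  refine compactlyGeneratedSpace_of_continuous_maps fun {W} _ f h => ?_
  have h' : ∀ (K : Type u) [TopologicalSpace K] [CompactSpace K] [T2Space K] (g : K → X),
      Continuous g → Continuous (fun p : K × L => f (p.2, g p.1)) := fun K _ _ _ g hg =>
    h (K × L) (fun p => (p.2, g p.1)) (by fun_prop)
  have hx : ∀ x, Continuous fun l => f (l, x) := fun x =>
    (h' PUnit (fun _ => x) continuous_const).comp (by fun_prop : Continuous fun l => (PUnit.unit, l))
  let G : X → C(L, W) := fun x => ⟨_, hx x⟩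
  have hG : Continuous G := continuous_from_compactlyGeneratedSpace _ fun K _ _ _ g hg =>
    (ContinuousMap.curry ⟨_, h' K g hg⟩).continuous
  exact (ContinuousMap.continuous_uncurry_of_continuous ⟨G, hG⟩).comp continuous_swap

instance instCGQuot {r : X → X → Prop} [CompactlyGeneratedSpace X] :
    CompactlyGeneratedSpace (Quot r) :=
  compactlyGeneratedSpace_of_coinduced continuous_quot_mk rfl

/-- In compactly generated spaces, the product of a quotient map with a space is a quotient map. -/
lemma continuous_lift_kprod [CompactlyGeneratedSpace Y] {B : Type u} [TopologicalSpace B]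
    {q : Y → B} (hq : IsQuotientMap q) {g : X × B → Z}
    (hg : Continuous fun p : Kify (X × Y) => g ((ofK p).1, q (ofK p).2)) :
    Continuous fun p : Kify (X × B) => g (ofK p) := by
  refine continuous_Kify_dom fun K _ _ _ f hf => ?_
  have h1 : Continuous fun p : K × Y => toK ((f p.1).1, p.2) :=
    continuous_toK (by fun_prop)
  have h2 : Continuous fun p : K × B => g ((f p.1).1, p.2) :=
    hq.continuous_lift_prod_right (g := fun p : K × B => g ((f p.1).1, p.2)) (hg.comp h1)
  exact h2.comp (continuous_id.prodMk (continuous_snd.comp hf))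

end Kify

/-! ## Pointed spaces -/

/-- Pointed compactly generated spaces. -/
structure PtCG : Type (u + 1) where
  carrier : Type u
  [top : TopologicalSpace carrier]
  [cg : CompactlyGeneratedSpace carrier]
  pt : carrier

namespace PtCG

instance : CoeSort PtCG.{u} (Type u) := ⟨PtCG.carrier⟩

instance (X : PtCG.{u}) : TopologicalSpace X := X.top
instance (X : PtCG.{u}) : CompactlyGeneratedSpace X := X.cg

/-- Pointed continuous maps. -/
@[ext]
structure Hom (X Y : PtCG.{u}) : Type u where
  hom : C(X, Y)
  map_pt : hom X.pt = Y.pt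

instance : Category PtCG.{u} where
  Hom := Hom
  id X := ⟨ContinuousMap.id X, rfl⟩
  comp f g := ⟨g.hom.comp f.hom, by simp [f.map_pt, g.map_pt]⟩

instance (X Y : PtCG.{u}) : CoeFun (X ⟶ Y) (fun _ => X → Y) := ⟨fun f => f.hom⟩

/-- Constructor for pointed maps. -/
def mkHom {X Y : PtCG.{u}} (f : X → Y) (hf : Continuous f) (h : f X.pt = Y.pt) : X ⟶ Y :=
  Hom.mk ⟨f, hf⟩ h

@[simp] lemma mkHom_apply {X Y : PtCG.{u}} (f : X → Y) (hf : Continuous f) (h : f X.pt = Y.pt)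
    (x : X) : (mkHom f hf h) x = f x := rfl

@[simp] lemma id_apply {X : PtCG.{u}} (x : X) : (𝟙 X : X ⟶ X) x = x := rfl

@[simp] lemma comp_apply {X Y Z : PtCG.{u}} (f : X ⟶ Y) (g : Y ⟶ Z) (x : X) :
    (f ≫ g) x = g (f x) := rfl

@[simp] lemma apply_pt {X Y : PtCG.{u}} (f : X ⟶ Y) : f X.pt = Y.pt := f.map_pt

lemma hom_continuous {X Y : PtCG.{u}} (f : X ⟶ Y) : Continuous (fun x => f x) := f.hom.continuous

lemma hom_ext {X Y : PtCG.{u}} {f g : X ⟶ Y} (h : ∀ x, f x = g x) : f = g :=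
  Hom.ext (ContinuousMap.ext h)

lemma congr_apply {X Y : PtCG.{u}} {f g : X ⟶ Y} (h : f = g) (x : X) : f x = g x := by rw [h]

/-- The constant map to the basepoint. -/
def zeroHom (X Y : PtCG.{u}) : X ⟶ Y := mkHom (fun _ => Y.pt) continuous_const rfl

/-- The mapping space: the set of pointed maps with the compactly generated refinement of the
compact-open topology. -/
instance mapTop (X Y : PtCG.{u}) : TopologicalSpace (X ⟶ Y) :=
  @TopologicalSpace.compactlyGenerated.{u} (X ⟶ Y)
    (TopologicalSpace.induced (fun f : X ⟶ Y => f.hom) inferInstance)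

end PtCG

/-- The basepoint `x₀` of `X` is nondegenerate: `(X, {x₀})` is an NDR pair. -/
def Nondegenerate (X : Type u) [TopologicalSpace X] (x₀ : X) : Prop :=
  ∃ (v : X → I) (h : X × I → X), Continuous v ∧ Continuous h ∧
    (∀ x, v x = 0 ↔ x = x₀) ∧ (∀ x, h (x, 0) = x) ∧ (∀ t, h (x₀, t) = x₀) ∧
    ∀ x, v x < 1 → h (x, 1) = x₀

/-- Spaces: compactly generated spaces with a nondegenerate basepoint. -/
structure Sp : Type (u + 1) extends PtCG.{u} where
  nondegenerate : Nondegenerate carrier pt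

namespace Sp

instance : CoeSort Sp.{u} (Type u) := ⟨fun X => X.toPtCG.carrier⟩

instance : Category Sp.{u} where
  Hom X Y := X.toPtCG ⟶ Y.toPtCG
  id X := 𝟙 X.toPtCG
  comp {X Y Z} f g := (show X.toPtCG ⟶ Y.toPtCG from f) ≫ (show Y.toPtCG ⟶ Z.toPtCG from g)

/-- The inclusion of spaces into all pointed compactly generated spaces. -/
def forget : Sp.{u} ⥤ PtCG.{u} where
  obj X := X.toPtCG
  map f := f

instance (X Y : Sp.{u}) : CoeFun (X ⟶ Y) (fun _ => X → Y) := ⟨fun f => PtCG.Hom.hom f⟩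

instance (X Y : Sp.{u}) : TopologicalSpace (X ⟶ Y) := PtCG.mapTop X.toPtCG Y.toPtCG

end Sp

/-! ## Weak equivalences -/

/-- The map induced by a continuous map on based `k`-cubes. -/
def genLoopMap {X Y : Type u} [TopologicalSpace X] [TopologicalSpace Y] (f : C(X, Y)) (k : ℕ)
    (x : X) (γ : GenLoop (Fin k) X x) : GenLoop (Fin k) Y (f x) :=
  ⟨f.comp γ.1, fun y hy => congrArg f (γ.2 y hy)⟩

/-- The map induced by a continuous map on `π_k`. -/
def piMap {X Y : Type u} [TopologicalSpace X] [TopologicalSpace Y] (f : C(X, Y)) (k : ℕ) (x : X) :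
    HomotopyGroup (Fin k) X x → HomotopyGroup (Fin k) Y (f x) :=
  Quotient.map (genLoopMap f k x) fun _ _ h => ContinuousMap.HomotopicRel.comp_continuousMap h f

/-- Weak homotopy equivalences of pointed (hence nonempty) spaces: bijective on `π_k`, `k ≥ 0`, at
every basepoint. -/
def IsWeakEquiv {X Y : PtCG.{u}} (f : X ⟶ Y) : Prop :=
  ∀ (k : ℕ) (x : X), Function.Bijective (piMap f.hom k x)

/-! ## Smash products -/

namespace PtCG

/-- The relation collapsing `X ∨ Y ⊆ X × Y` to a point. -/
def smashRel (X Y : PtCG.{u}) (p q : Kify (X × Y)) : Prop :=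
  ((ofK p).1 = X.pt ∨ (ofK p).2 = Y.pt) ∧ ((ofK q).1 = X.pt ∨ (ofK q).2 = Y.pt)

/-- The smash product `X ∧ Y`, where `X × Y` has the compactly generated product topology. -/
def smash (X Y : PtCG.{u}) : PtCG.{u} where
  carrier := Quot (smashRel X Y)
  pt := Quot.mk _ (toK (X.pt, Y.pt))

/-- The point `x ∧ y`. -/
def smashMk {X Y : PtCG.{u}} (x : X) (y : Y) : smash X Y := Quot.mk _ (toK (x, y))

lemma smash_ind {X Y : PtCG.{u}} {P : smash X Y → Prop} (h : ∀ x y, P (smashMk x y)) (z) : P z :=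
  Quot.ind (fun p => h (ofK p).1 (ofK p).2) z

lemma smashMk_pt_left {X Y : PtCG.{u}} (y : Y) : smashMk X.pt y = (smash X Y).pt :=
  Quot.sound ⟨Or.inl rfl, Or.inl rfl⟩

lemma smashMk_pt_right {X Y : PtCG.{u}} (x : X) : smashMk x Y.pt = (smash X Y).pt :=
  Quot.sound ⟨Or.inr rfl, Or.inl rfl⟩

lemma continuous_smashMk {X Y : PtCG.{u}} :
    Continuous fun p : Kify (X × Y) => smashMk (ofK p).1 (ofK p).2 :=
  continuous_quot_mk

/-- Maps out of a smash product. -/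
def smashLift {X Y : PtCG.{u}} {Z : Type v} (f : X → Y → Z) (z : Z)
    (hx : ∀ y, f X.pt y = z) (hy : ∀ x, f x Y.pt = z) : smash X Y → Z :=
  Quot.lift (fun p => f (ofK p).1 (ofK p).2) (by
    have key : ∀ p : Kify (X × Y), ((ofK p).1 = X.pt ∨ (ofK p).2 = Y.pt) →
        f (ofK p).1 (ofK p).2 = z := by
      rintro p (h | h) <;> rw [h]
      · exact hx _
      · exact hy _
    rintro p q ⟨h1, h2⟩
    rw [key p h1, key q h2])

lemma continuous_smashLift {X Y : PtCG.{u}} {Z : Type v} [TopologicalSpace Z] (f : X → Y → Z)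
    (z : Z) (hx : ∀ y, f X.pt y = z) (hy : ∀ x, f x Y.pt = z)
    (hf : Continuous fun p : Kify (X × Y) => f (ofK p).1 (ofK p).2) :
    Continuous (smashLift f z hx hy) :=
  continuous_quot_lift _ hf

/-- `X ∧ f`. -/
def smashMap (X : PtCG.{u}) {Y Z : PtCG.{u}} (f : Y ⟶ Z) : smash X Y ⟶ smash X Z :=
  mkHom (smashLift (fun x y => smashMk x (f y)) (smash X Z).pt
      (fun y => smashMk_pt_left _) (fun x => by rw [apply_pt, smashMk_pt_right]))
    (continuous_smashLift _ _ _ _ (continuous_smashMk.comp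
      (continuous_Kify_map (g := fun p : X × Y => (p.1, f p.2))
        (continuous_fst.prodMk ((hom_continuous f).comp continuous_snd)))))
    (by change smashMk X.pt (f Y.pt) = _; rw [smashMk_pt_left])

lemma smash_nondegenerate {X Y : PtCG.{u}} (hX : Nondegenerate X X.pt)
    (hY : Nondegenerate Y Y.pt) : Nondegenerate (smash X Y) (smash X Y).pt := by
  obtain ⟨v, h, hv, hh, v0, h0, hp, h1⟩ := hX
  obtain ⟨w, k, hw, hk, w0, k0, kp, k1⟩ := hY
  have hvx : v X.pt = 0 := (v0 _).2 rfl
  have hwy : w Y.pt = 0 := (w0 _).2 rfl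
  have min0 : ∀ a : I, min a 0 = 0 := fun a => min_eq_right a.2.1
  have c1 : Continuous fun p : Kify (X × Y) × I =>
      smashMk (h ((ofK p.1).1, p.2)) (k ((ofK p.1).2, p.2)) :=
    continuous_smashMk.comp (continuous_toK (g := fun p : Kify (X × Y) × I =>
      (h ((ofK p.1).1, p.2), k ((ofK p.1).2, p.2))) (by fun_prop))
  let H : smash X Y → C(I, smash X Y) := smashLift
    (fun x y => ⟨fun t => smashMk (h (x, t)) (k (y, t)),
      c1.comp (by fun_prop : Continuous fun t : I => (toK (x, y), t))⟩)
    (ContinuousMap.const _ (smash X Y).pt)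
    (fun y => by ext t; simp [hp, smashMk_pt_left])
    (fun x => by ext t; simp [kp, smashMk_pt_right])
  have cH : Continuous H := continuous_smashLift _ _ _ _ (ContinuousMap.curry ⟨_, c1⟩).continuous
  refine ⟨smashLift (fun x y => min (v x) (w y)) 0 (fun y => ?_) (fun x => ?_),
    fun p => H p.1 p.2, continuous_smashLift _ _ _ _ ?_,
    ContinuousMap.continuous_uncurry_of_continuous ⟨H, cH⟩, ?_, ?_, ?_, ?_⟩
  · rw [hvx, min_comm]; exact min0 _
  · rw [hwy]; exact min0 _
  · fun_prop
  · intro z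
    induction z using smash_ind with | h x y => ?_
    constructor
    · intro e
      change min (v x) (w y) = 0 at e
      rcases min_choice (v x) (w y) with e' | e'
      · rw [(v0 x).1 (e'.symm.trans e), smashMk_pt_left]
      · rw [(w0 y).1 (e'.symm.trans e), smashMk_pt_right]
    · intro e
      rw [e]
      change min (v X.pt) (w Y.pt) = 0
      rw [hwy, min0]
  · intro z
    induction z using smash_ind with | h x y => ?_
    change smashMk (h (x, 0)) (k (y, 0)) = _
    rw [h0, k0]
  · intro t
    change smashMk (h (X.pt, t)) (k (Y.pt, t)) = _
    rw [hp, kp]; rfl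
  · intro z
    induction z using smash_ind with | h x y => ?_
    intro e
    change min (v x) (w y) < 1 at e
    change smashMk (h (x, 1)) (k (y, 1)) = _
    rcases min_lt_iff.1 e with e | e
    · rw [h1 x e, smashMk_pt_left]
    · rw [k1 y e, smashMk_pt_right]

end PtCG

/-- The functor `X ∧ -`. -/
def smashFunctor (X : Sp.{u}) : Sp.{u} ⥤ Sp.{u} where
  obj Y := ⟨PtCG.smash X.toPtCG Y.toPtCG, PtCG.smash_nondegenerate X.2 Y.2⟩
  map f := PtCG.smashMap X.toPtCG f
  map_id Y := PtCG.hom_ext fun z => by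
    induction z using PtCG.smash_ind with | h x y => rfl
  map_comp f g := PtCG.hom_ext fun z => by
    induction z using PtCG.smash_ind with | h x y => rfl

/-- The shifted functor `F_X = F(X ∧ -)`. -/
def shift (X : Sp.{u}) (F : Sp.{u} ⥤ PtCG.{u}) : Sp.{u} ⥤ PtCG.{u} := smashFunctor X ⋙ F

/-! ## Continuous functors -/

/-- `F` is continuous if `Map(X, Y) → Map(F X, F Y)` is continuous for all `X`, `Y`. -/
def IsContinuousFunctor (F : Sp.{u} ⥤ PtCG.{u}) : Prop :=
  ∀ X Y : Sp.{u}, Continuous fun f : X ⟶ Y => F.map f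

namespace PtCG

/-- A family of pointed maps parametrized by a compact Hausdorff space is continuous as a map to the
mapping space exactly if it is jointly continuous. -/
lemma continuous_map_iff {X Y : PtCG.{u}} {K : Type u} [TopologicalSpace K] [CompactSpace K]
    [T2Space K] {g : K → (X ⟶ Y)} :
    Continuous g ↔ Continuous fun p : K × X => g p.1 p.2 := by
  let t : TopologicalSpace (X ⟶ Y) :=
    TopologicalSpace.induced (fun f : X ⟶ Y => f.hom) inferInstance
  have e : Continuous[_, mapTop X Y] g ↔ Continuous[_, t] g :=
    ⟨fun h => (continuous_ofK (X := (X ⟶ Y))).comp h, fun h => continuous_toK_of_compact h⟩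
  rw [e, continuous_induced_rng]
  constructor
  · intro h
    refine continuous_from_compactlyGeneratedSpace _ fun L _ _ _ f hf => ?_
    have h1 : Continuous fun l => ((g (f l).1).hom.comp ⟨fun l => (f l).2, hf.snd⟩ : C(L, Y)) :=
      (ContinuousMap.continuous_precomp _).comp (h.comp hf.fst)
    exact (ContinuousMap.continuous_uncurry_of_continuous ⟨_, h1⟩).comp
      (continuous_id.prodMk continuous_id)
  · intro h
    exact (ContinuousMap.curry ⟨_, h⟩).continuous

/-- A map out of the mapping space is continuous if it is so on compact Hausdorff families. -/
lemma continuous_map_dom {X Y : PtCG.{u}} {Z : Type u} [TopologicalSpace Z] {φ : (X ⟶ Y) → Z}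
    (h : ∀ (K : Type u) [TopologicalSpace K] [CompactSpace K] [T2Space K] (g : K → (X ⟶ Y)),
      Continuous g → Continuous (fun k => φ (g k))) : Continuous φ := by
  refine @continuous_Kify_dom (X ⟶ Y) Z
    (TopologicalSpace.induced (fun f : X ⟶ Y => f.hom) inferInstance) _ φ ?_
  intro K _ _ _ f hf
  exact h K f (@continuous_toK_of_compact (X ⟶ Y)
    (TopologicalSpace.induced (fun f : X ⟶ Y => f.hom) inferInstance) K _ _ _ f hf)

/-- Evaluation is continuous. -/
lemma continuous_eval {X Y : PtCG.{u}} :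
    Continuous fun p : Kify (X × (X ⟶ Y)) => (ofK p).2 (ofK p).1 :=
  continuous_Kify_dom fun _ _ _ _ _ hf =>
    (continuous_map_iff.1 hf.snd).comp (continuous_id.prodMk hf.fst)

lemma continuous_precomp {X Y Z : PtCG.{u}} (f : X ⟶ Y) :
    Continuous fun g : Y ⟶ Z => f ≫ g :=
  continuous_map_dom fun _ _ _ _ _ hg => continuous_map_iff.2
    ((continuous_map_iff.1 hg).comp (continuous_fst.prodMk ((hom_continuous f).comp continuous_snd)))

lemma continuous_postcomp {X Y Z : PtCG.{u}} (f : Y ⟶ Z) :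
    Continuous fun g : X ⟶ Y => g ≫ f :=
  continuous_map_dom fun _ _ _ _ _ hg => continuous_map_iff.2
    ((hom_continuous f).comp (continuous_map_iff.1 hg))

lemma continuous_smashMap (X : PtCG.{u}) {Y Z : PtCG.{u}} :
    Continuous fun f : Y ⟶ Z => smashMap X f :=
  continuous_map_dom fun K _ _ _ g hg => continuous_map_iff.2 (by
    have hq : IsQuotientMap (Quot.mk (smashRel X Y)) := isQuotientMap_quot_mk
    refine hq.continuous_lift_prod_right
      (g := fun p : K × smash X Y => smashMap X (g p.1) p.2) ?_
    have h := continuous_map_iff.1 hg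
    exact continuous_smashMk.comp (continuous_toK (g := fun p : K × Kify (X × Y) =>
      ((ofK p.2).1, g p.1 (ofK p.2).2)) (((continuous_ofK.comp continuous_snd).fst).prodMk
        (h.comp (continuous_fst.prodMk (continuous_ofK.comp continuous_snd).snd)))))

end PtCG

lemma IsContinuousFunctor.shift {F : Sp.{u} ⥤ PtCG.{u}} (hF : IsContinuousFunctor F) (X : Sp.{u}) :
    IsContinuousFunctor (shift X F) := fun Y Z =>
  (hF ((smashFunctor X).obj Y) ((smashFunctor X).obj Z)).comp
    (PtCG.continuous_smashMap X.toPtCG (Y := Y.toPtCG) (Z := Z.toPtCG))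

/-! ## The homotopy left Kan extension from finite pointed sets -/

/-- The finite pointed set `[n] = {0, …, n}` with basepoint `0`, as a discrete space. -/
def finSp (n : ℕ) : Sp.{u} where
  carrier := ULift.{u} (Fin (n + 1))
  pt := ⟨0⟩
  nondegenerate :=
    ⟨fun x => if x = ⟨0⟩ then 0 else 1, Prod.fst, continuous_of_discreteTopology, continuous_fst,
      by simp, fun _ => rfl, fun _ => rfl, fun x => by
        by_cases hx : x = ⟨0⟩ <;> simp [hx]⟩

/-- The sphere `S⁰`. -/
abbrev sphereZero : Sp.{u} := finSp 1

/-- The small category of finite pointed sets `[n]`, a full subcategory of spaces. -/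
structure FinPt : Type u where
  card : ℕ

/-- The finite pointed set as a space. -/
def FinPt.sp (C : FinPt.{u}) : Sp.{u} := finSp C.card

instance : Category.{u} FinPt.{u} where
  Hom C D := C.sp ⟶ D.sp
  id C := 𝟙 C.sp
  comp {C D E} f g := (show C.sp ⟶ D.sp from f) ≫ (show D.sp ⟶ E.sp from g)

/-- The inclusion of finite pointed sets into spaces. -/
def FinPt.incl : FinPt.{u} ⥤ Sp.{u} where
  obj C := C.sp
  map f := f

/-- Chains `C_0 ⟶ ⋯ ⟶ C_n` of finite pointed sets. -/
abbrev Chain (n : SimplexCategory) : Type u := Fin (n.len + 1) ⥤ FinPt.{u}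

namespace Chain

/-- The space underlying the `i`-th object of a chain. -/
def sp {n : SimplexCategory} (c : Chain.{u} n) (i : Fin (n.len + 1)) : Sp.{u} :=
  FinPt.incl.obj (c.obj i)

/-- The transition map `C_i ⟶ C_j` of a chain. -/
def hom {n : SimplexCategory} (c : Chain.{u} n) {i j : Fin (n.len + 1)} (h : i ≤ j) :
    c.sp i ⟶ c.sp j :=
  FinPt.incl.map (c.map (homOfLE h))

lemma hom_refl {n : SimplexCategory} (c : Chain.{u} n) (i : Fin (n.len + 1)) :
    c.hom (le_refl i) = 𝟙 (c.sp i) :=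
  congrArg FinPt.incl.map (c.map_id i)

lemma hom_comp {n : SimplexCategory} (c : Chain.{u} n) {i j k : Fin (n.len + 1)} (h : i ≤ j)
    (h' : j ≤ k) : c.hom h ≫ c.hom h' = c.hom (h.trans h') :=
  congrArg FinPt.incl.map (c.map_comp (homOfLE h) (homOfLE h')).symm

/-- The chain `θ^* c` for `θ : [m] ⟶ [n]`. -/
def pull {m n : SimplexCategory} (θ : m ⟶ n) (c : Chain.{u} n) : Chain.{u} m :=
  θ.toOrderHom.monotone.functor ⋙ c

end Chain

namespace Bar

variable (F : Sp.{u} ⥤ PtCG.{u}) (Y : Sp.{u})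

/-- The disjoint union over chains of `F(C_0) × Map(C_n, Y)`. -/
abbrev Pre (n : SimplexCategory) : Type u :=
  Σ c : Chain.{u} n, Kify (F.obj (c.sp 0) × (c.sp (Fin.last _) ⟶ Y))

/-- The relation that identifies all points whose coordinate in `F(C_0)` is the basepoint. It turns
`∐ F(C_0) × M` into `⋁ F(C_0) ∧ M_+`. -/
def rel (n : SimplexCategory) (p q : Pre F Y n) : Prop :=
  (ofK p.2).1 = (F.obj (p.1.sp 0)).pt ∧ (ofK q.2).1 = (F.obj (q.1.sp 0)).pt

/-- The simplicial operator of `θ : [m] ⟶ [n]` before collapsing: it sends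
`(c, x, f)` to `(θ^* c, F(C_0 ⟶ C_{θ 0}) x, C_{θ m} ⟶ C_n ⟶ Y)`. -/
def preMap {m n : SimplexCategory} (θ : m ⟶ n) (p : Pre F Y n) : Pre F Y m :=
  ⟨p.1.pull θ, toK
    (F.map (p.1.hom (Fin.zero_le (θ.toOrderHom 0))) (ofK p.2).1,
      p.1.hom (Fin.le_last (θ.toOrderHom (Fin.last _))) ≫ (ofK p.2).2)⟩

variable {F Y}

lemma pre_ext {n : SimplexCategory} {c : Chain.{u} n} {x x' : F.obj (c.sp 0)}
    {f f' : c.sp (Fin.last _) ⟶ Y} (hx : x = x') (hf : f = f') :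
    (⟨c, toK (x, f)⟩ : Pre F Y n) = ⟨c, toK (x', f')⟩ := by
  rw [hx, hf]

lemma preMap_id (n : SimplexCategory) (p : Pre F Y n) : preMap F Y (𝟙 n) p = p := by
  obtain ⟨c, p⟩ := p
  refine pre_ext (c := c) (x' := (ofK p).1) (f' := (ofK p).2) ?_ ?_
  · exact (PtCG.congr_apply (congrArg (fun g => F.map g) (c.hom_refl 0)) _).trans
      (PtCG.congr_apply (F.map_id _) _)
  · exact (congrArg (fun g => g ≫ (ofK p).2) (c.hom_refl _)).trans (Category.id_comp _)

lemma preMap_comp {l m n : SimplexCategory} (φ : l ⟶ m) (θ : m ⟶ n) (p : Pre F Y n) :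
    preMap F Y (φ ≫ θ) p = preMap F Y φ (preMap F Y θ p) := by
  obtain ⟨c, p⟩ := p
  refine pre_ext (c := c.pull (φ ≫ θ)) ?_ ?_
  · exact (PtCG.congr_apply (congrArg (fun g => F.map g) (c.hom_comp
      (Fin.zero_le (θ.toOrderHom 0)) (θ.toOrderHom.monotone (Fin.zero_le (φ.toOrderHom 0))))) _).symm.trans
      (PtCG.congr_apply (F.map_comp _ _) _)
  · exact (congrArg (fun g => g ≫ (ofK p).2) (c.hom_comp
      (θ.toOrderHom.monotone (Fin.le_last (φ.toOrderHom (Fin.last _))))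
      (Fin.le_last (θ.toOrderHom (Fin.last _))))).symm.trans (Category.assoc _ _ _)

lemma continuous_preMap {m n : SimplexCategory} (θ : m ⟶ n) : Continuous (preMap F Y θ) :=
  continuous_sigma fun c => (@continuous_sigmaMk (Chain.{u} m) (fun c => Kify (F.obj (c.sp 0) × (c.sp (Fin.last _) ⟶ Y)))
    _ (c.pull θ)).comp (continuous_Kify_map
    (g := fun q : F.obj (c.sp 0) × (c.sp (Fin.last _) ⟶ Y) =>
      (F.map (c.hom (Fin.zero_le (θ.toOrderHom 0))) q.1,
        c.hom (Fin.le_last (θ.toOrderHom (Fin.last _))) ≫ q.2))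
    (((PtCG.hom_continuous _).comp continuous_fst).prodMk
      ((PtCG.continuous_precomp _).comp continuous_snd)))

lemma preMap_rel {m n : SimplexCategory} (θ : m ⟶ n) (p q : Pre F Y n) (h : rel F Y n p q) :
    rel F Y m (preMap F Y θ p) (preMap F Y θ q) :=
  ⟨(congrArg _ h.1).trans (PtCG.apply_pt _), (congrArg _ h.2).trans (PtCG.apply_pt _)⟩

variable (F Y)

/-- The base point of `∐ F(C_0) × Map(C_n, Y)` before collapsing. -/
def prePt (n : SimplexCategory) : Pre F Y n :=
  ⟨(Functor.const _).obj ⟨0⟩, toK (PtCG.pt _, PtCG.zeroHom _ _)⟩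

/-- The space `⋁ F(C_0) ∧ (S(C_0, C_1) × ⋯ × Map(C_n, Y))_+` of `n`-simplices. -/
def space (n : SimplexCategory) : PtCG.{u} where
  carrier := Quot (rel F Y n)
  pt := Quot.mk _ (prePt F Y n)

/-- The simplicial operator of `θ : [m] ⟶ [n]`. -/
def spaceMap {m n : SimplexCategory} (θ : m ⟶ n) : space F Y n ⟶ space F Y m :=
  PtCG.mkHom (Quot.map (preMap F Y θ) (preMap_rel θ))
    (continuous_quot_lift _ (continuous_quot_mk.comp (continuous_preMap θ)))
    (Quot.sound ⟨PtCG.apply_pt _, rfl⟩)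

/-- The simplicial space whose realization is the left Kan extension at `Y`. -/
def simplicial : SimplexCategoryᵒᵖ ⥤ PtCG.{u} where
  obj n := space F Y n.unop
  map θ := spaceMap F Y θ.unop
  map_id n := PtCG.hom_ext fun z => by
    induction z using Quot.ind with | mk p => exact congrArg (Quot.mk _) (preMap_id n.unop p)
  map_comp θ φ := PtCG.hom_ext fun z => by
    induction z using Quot.ind with
    | mk p => exact congrArg (Quot.mk _) (preMap_comp φ.unop θ.unop p)

variable {F Y}

/-- Functoriality in `Y`. -/
def spaceMapY {Z : Sp.{u}} (g : Y ⟶ Z) (n : SimplexCategory) : space F Y n ⟶ space F Z n :=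
  PtCG.mkHom
    (Quot.map (fun p => ⟨p.1, toK ((ofK p.2).1, (ofK p.2).2 ≫ g)⟩) fun _ _ h => h)
    (continuous_quot_lift _ (continuous_quot_mk.comp (continuous_sigma fun c =>
      continuous_sigmaMk.comp (continuous_Kify_map
        (g := fun q : F.obj (c.sp 0) × (c.sp (Fin.last _) ⟶ Y) => (q.1, q.2 ≫ g))
        (continuous_fst.prodMk ((PtCG.continuous_postcomp _).comp continuous_snd))))))
    (Quot.sound ⟨rfl, rfl⟩)

variable (F) in
/-- The simplicial space as a functor of `Y`. -/
def simplicialFunctor : Sp.{u} ⥤ (SimplexCategoryᵒᵖ ⥤ PtCG.{u}) where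
  obj Y := simplicial F Y
  map g :=
    { app := fun n => spaceMapY g n.unop
      naturality := fun _ _ _ => PtCG.hom_ext fun z => by
        induction z using Quot.ind with | mk p => rfl }
  map_id Y := by
    ext n
    refine PtCG.hom_ext fun z => ?_
    induction z using Quot.ind with | mk p => rfl
  map_comp f g := by
    ext n
    refine PtCG.hom_ext fun z => ?_
    induction z using Quot.ind with | mk p => rfl

/-- The augmentation of the `n`-simplices: `(c, x, f)` is sent to `F(C_0 ⟶ C_n ⟶ Y) x`. -/
def aug (hF : IsContinuousFunctor F) (Y : Sp.{u}) (n : SimplexCategory) :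
    space F Y n ⟶ F.obj Y :=
  PtCG.mkHom
    (Quot.lift (fun p => F.map (p.1.hom (Fin.zero_le (Fin.last _)) ≫
        (ofK p.2).2) (ofK p.2).1) fun _ _ h =>
      ((congrArg _ h.1).trans (PtCG.apply_pt _)).trans
        ((congrArg _ h.2).trans (PtCG.apply_pt _)).symm)
    (continuous_quot_lift _ (continuous_sigma fun c => PtCG.continuous_eval.comp
      (continuous_Kify_map
        (g := fun q : F.obj (c.sp 0) × (c.sp (Fin.last _) ⟶ Y) =>
          (q.1, F.map (c.hom (Fin.zero_le (Fin.last _)) ≫ q.2)))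
        (continuous_fst.prodMk (((hF _ _).comp (PtCG.continuous_precomp _)).comp
          continuous_snd)))))
    (PtCG.apply_pt _)

lemma aug_spaceMap (hF : IsContinuousFunctor F) {m n : SimplexCategory} (θ : m ⟶ n) :
    spaceMap F Y θ ≫ aug hF Y m = aug hF Y n := by
  refine PtCG.hom_ext fun z => ?_
  induction z using Quot.ind with
  | mk p =>
    obtain ⟨c, p⟩ := p
    have h' : c.hom (Fin.zero_le (θ.toOrderHom 0)) ≫
        c.hom (θ.toOrderHom.monotone (Fin.zero_le (Fin.last _))) ≫
          c.hom (Fin.le_last (θ.toOrderHom (Fin.last _))) ≫ (ofK p).2 =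
        c.hom (Fin.zero_le (Fin.last _)) ≫ (ofK p).2 := by
      rw [← Category.assoc, ← Category.assoc, c.hom_comp, c.hom_comp]
    exact (PtCG.congr_apply (F.map_comp _ _) _).symm.trans
      (PtCG.congr_apply (congrArg (fun g => F.map g) h') _)

lemma aug_natural (hF : IsContinuousFunctor F) {Z : Sp.{u}} (g : Y ⟶ Z) (n : SimplexCategory) :
    spaceMapY g n ≫ aug hF Z n = aug hF Y n ≫ F.map g := by
  refine PtCG.hom_ext fun z => ?_
  induction z using Quot.ind with
  | mk p => exact PtCG.congr_apply ((congrArg (fun g => F.map g) (Category.assoc _ _ _).symm).trans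
      (F.map_comp _ _)) _

end Bar

/-! ## The thick realization -/

namespace Thick

/-- The face identifications `(θ^* a, t) ∼ (a, θ_* t)` for injective `θ`. -/
inductive Rel (A : SimplexCategoryᵒᵖ ⥤ PtCG.{u}) :
    (Σ n : SimplexCategory, A.obj (.op n) × stdSimplex ℝ (Fin (n.len + 1))) →
    (Σ n : SimplexCategory, A.obj (.op n) × stdSimplex ℝ (Fin (n.len + 1))) → Prop
  | face {m n : SimplexCategory} (θ : m ⟶ n) (hθ : Function.Injective θ.toOrderHom)
      (a : A.obj (.op n)) (t : stdSimplex ℝ (Fin (m.len + 1))) :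
      Rel A ⟨m, A.map θ.op a, t⟩ ⟨n, a, stdSimplex.map θ.toOrderHom t⟩

/-- The thick geometric realization of a simplicial space, with basepoint that of the `0`-simplices.
-/
def real (A : SimplexCategoryᵒᵖ ⥤ PtCG.{u}) : PtCG.{u} where
  carrier := Quot (Rel A)
  pt := Quot.mk _ ⟨SimplexCategory.mk 0, PtCG.pt _, (default : stdSimplex ℝ (Fin 1))⟩

/-- The map of realizations induced by a simplicial map. -/
def realMap {A B : SimplexCategoryᵒᵖ ⥤ PtCG.{u}} (α : A ⟶ B) : real A ⟶ real B :=
  PtCG.mkHom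
    (Quot.map (fun p => ⟨p.1, α.app _ p.2.1, p.2.2⟩) (by
      rintro _ _ ⟨θ, hθ, a, t⟩
      have h : α.app _ (A.map θ.op a) = B.map θ.op (α.app _ a) :=
        PtCG.congr_apply (α.naturality θ.op) a
      dsimp only
      rw [h]
      exact .face θ hθ _ t))
    (continuous_quot_lift _ (continuous_quot_mk.comp (continuous_sigma fun n =>
      continuous_sigmaMk.comp (((PtCG.hom_continuous (α.app (.op n))).comp continuous_fst).prodMk
        continuous_snd))))
    (by change Quot.mk _ _ = Quot.mk _ _; dsimp only; rw [PtCG.apply_pt])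

/-- Thick realization as a functor. -/
def realFunctor : (SimplexCategoryᵒᵖ ⥤ PtCG.{u}) ⥤ PtCG.{u} where
  obj A := real A
  map α := realMap α
  map_id A := PtCG.hom_ext fun z => by induction z using Quot.ind with | mk p => rfl
  map_comp α β := PtCG.hom_ext fun z => by induction z using Quot.ind with | mk p => rfl

/-- The map from the realization to a space under an augmentation. -/
def realLift {A : SimplexCategoryᵒᵖ ⥤ PtCG.{u}} {Z : PtCG.{u}}
    (ε : ∀ n : SimplexCategory, A.obj (.op n) ⟶ Z)
    (hε : ∀ {m n : SimplexCategory} (θ : m ⟶ n), A.map θ.op ≫ ε m = ε n) : real A ⟶ Z :=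
  PtCG.mkHom
    (Quot.lift (fun p => ε p.1 p.2.1) (by
      rintro _ _ ⟨θ, hθ, a, t⟩
      exact PtCG.congr_apply (hε θ) a))
    (continuous_quot_lift _ (continuous_sigma fun n =>
      (PtCG.hom_continuous (ε n)).comp continuous_fst))
    (PtCG.apply_pt _)

end Thick

/-- The homotopy invariant left Kan extension `LF` of `F` along the inclusion of finite pointed sets
into spaces. -/
def leftKan (F : Sp.{u} ⥤ PtCG.{u}) : Sp.{u} ⥤ PtCG.{u} :=
  Bar.simplicialFunctor F ⋙ Thick.realFunctor

/-- The natural map `LF ⟶ F`, induced by `(x, f) ↦ F(f)(x)`. -/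
def leftKanCounit (F : Sp.{u} ⥤ PtCG.{u}) (hF : IsContinuousFunctor F) : leftKan F ⟶ F where
  app Y := Thick.realLift (A := Bar.simplicial F Y) (Bar.aug hF Y)
    (fun θ => Bar.aug_spaceMap hF θ)
  naturality Y Z g := PtCG.hom_ext fun z => by
    induction z using Quot.ind with
    | mk p => exact PtCG.congr_apply (Bar.aug_natural hF g p.1) p.2.1

/-! ## Joins with finite sets -/

namespace Join

variable {ι : Type} (U : Finset ι)

/-- The relations of the mapping cone of the fold map `⋁_U Y ⟶ Y`: the bottom of each cone is glued
to `Y`, and each cone is reduced, with the cone point as basepoint. -/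
inductive Rel (Y : PtCG.{u}) :
    (Y ⊕ Σ _ : U, Y × I) → (Y ⊕ Σ _ : U, Y × I) → Prop
  | glue (i : U) (y : Y) : Rel Y (.inr ⟨i, y, 0⟩) (.inl y)
  | cone (i : U) (y : Y) : Rel Y (.inr ⟨i, y, 1⟩) (.inl Y.pt)
  | base (i : U) (s : I) : Rel Y (.inr ⟨i, Y.pt, s⟩) (.inl Y.pt)

/-- The (reduced) join `U * Y` of a finite set `U` and a pointed space `Y`: the mapping cone of the
fold map `⋁_U Y ⟶ Y`, that is, `U`-many reduced cones on `Y` glued along `Y`. -/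
def space (Y : PtCG.{u}) : PtCG.{u} where
  carrier := Quot (Rel U Y)
  pt := Quot.mk _ (.inl Y.pt)

variable {U}

/-- Maps out of the join. -/
def lift {Y : PtCG.{u}} {Z : Type v} (f : Y → Z) (g : U → Y → I → Z)
    (h0 : ∀ i y, g i y 0 = f y) (h1 : ∀ i y, g i y 1 = f Y.pt) (hb : ∀ i s, g i Y.pt s = f Y.pt) :
    space U Y → Z :=
  Quot.lift (Sum.elim f fun p => g p.1 p.2.1 p.2.2) (by
    rintro _ _ (⟨i, y⟩ | ⟨i, y⟩ | ⟨i, s⟩)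
    · exact h0 i y
    · exact h1 i y
    · exact hb i s)

lemma continuous_lift {Y : PtCG.{u}} {Z : Type v} [TopologicalSpace Z] {f : Y → Z}
    {g : U → Y → I → Z} {h0 : ∀ i y, g i y 0 = f y} {h1 : ∀ i y, g i y 1 = f Y.pt}
    {hb : ∀ i s, g i Y.pt s = f Y.pt} (hf : Continuous f)
    (hg : ∀ i, Continuous fun p : Y × I => g i p.1 p.2) : Continuous (lift f g h0 h1 hb) :=
  continuous_quot_lift _ (hf.sumElim (continuous_sigma hg))

/-- The points of the copy of `Y` in the join. -/
def inlPt {Y : PtCG.{u}} (y : Y) : space U Y := Quot.mk _ (.inl y)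

/-- The points of the cones in the join. -/
def conePt {Y : PtCG.{u}} (i : U) (y : Y) (s : I) : space U Y := Quot.mk _ (.inr ⟨i, y, s⟩)

lemma conePt_zero {Y : PtCG.{u}} (i : U) (y : Y) : conePt i y 0 = inlPt y :=
  Quot.sound (.glue i y)

lemma conePt_one {Y : PtCG.{u}} (i : U) (y : Y) : conePt i y 1 = inlPt Y.pt :=
  Quot.sound (.cone i y)

lemma conePt_pt {Y : PtCG.{u}} (i : U) (s : I) : conePt i Y.pt s = inlPt Y.pt :=
  Quot.sound (.base i s)

lemma continuous_inlPt {Y : PtCG.{u}} : Continuous (inlPt : Y → space U Y) :=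
  continuous_quot_mk.comp continuous_inl

lemma continuous_conePt {Y : PtCG.{u}} (i : U) :
    Continuous fun p : Y × I => (conePt i p.1 p.2 : space U Y) :=
  continuous_quot_mk.comp (continuous_inr.comp
    (@continuous_sigmaMk U (fun _ => Y × I) _ i))

lemma ind {Y : PtCG.{u}} {P : space U Y → Prop} (hl : ∀ y, P (inlPt y))
    (hc : ∀ i y s, P (conePt i y s)) (z) : P z :=
  Quot.ind (fun p => by
    rcases p with y | ⟨i, y, s⟩
    · exact hl y
    · exact hc i y s) z

/-- Auxiliary functions showing that the cone coordinate `1` is a nondegenerate basepoint of `I`. -/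
noncomputable def coneHt (s : I) : I := Set.projIcc 0 1 zero_le_one (2 * (1 - (s : ℝ)))

/-- The corresponding contracting homotopy, fixing `0`. -/
noncomputable def coneHtpy (s t : I) : I := Set.projIcc 0 1 zero_le_one ((s : ℝ) * (1 + t))

lemma space_nondegenerate {Y : PtCG.{u}} (hY : Nondegenerate Y Y.pt) :
    Nondegenerate (space U Y) (space U Y).pt := by
  obtain ⟨v, h, hv, hh, v0, h0, hp, h1⟩ := hY
  have hvy : v Y.pt = 0 := (v0 _).2 rfl
  have ck : Continuous fun p : I × I => coneHtpy p.1 p.2 := by unfold coneHtpy; fun_prop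
  have cw : Continuous coneHt := by unfold coneHt; fun_prop
  have w0 : coneHt 0 = 1 := by
    unfold coneHt; exact Set.projIcc_of_right_le _ (by norm_num)
  have w1 : coneHt 1 = 0 := by
    unfold coneHt; exact Set.projIcc_of_le_left _ (by norm_num)
  have wz : ∀ s, coneHt s = 0 → s = 1 := by
    intro s hs
    have := (Set.projIcc_eq_left (zero_lt_one' ℝ)).1 hs
    exact Subtype.ext (le_antisymm s.2.2 (by show (1 : ℝ) ≤ s; linarith))
  have wl : ∀ s, coneHt s < 1 → coneHtpy s 1 = 1 := by
    intro s hs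
    have h2 : ¬ (1 : ℝ) ≤ 2 * (1 - (s : ℝ)) := fun h =>
      hs.ne (Set.projIcc_of_right_le _ h)
    push Not at h2
    exact Set.projIcc_of_right_le _ (by show (1 : ℝ) ≤ s * (1 + 1); linarith)
  have k0 : ∀ s, coneHtpy s 0 = s := by
    intro s; unfold coneHtpy; simp
  have kz : ∀ t, coneHtpy 0 t = 0 := by
    intro t; unfold coneHtpy; exact Set.projIcc_of_le_left _ (by simp)
  have ko : ∀ t, coneHtpy 1 t = 1 := by
    intro t; unfold coneHtpy
    exact Set.projIcc_of_right_le _ (by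
      have := t.2.1
      simp only [Set.Icc.coe_one, one_mul]; linarith)
  have min0 : ∀ a : I, min a 0 = 0 := fun a => min_eq_right a.2.1
  have c0 : Continuous fun p : Y × I => (inlPt (h (p.1, p.2)) : space U Y) :=
    continuous_inlPt.comp (by fun_prop)
  have c1 : ∀ i : U, Continuous fun p : (Y × I) × I =>
      (conePt i (h (p.1.1, p.2)) (coneHtpy p.1.2 p.2) : space U Y) := fun i =>
    (continuous_conePt i).comp ((hh.comp ((continuous_fst.comp continuous_fst).prodMk
      continuous_snd)).prodMk (ck.comp ((continuous_snd.comp continuous_fst).prodMk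
      continuous_snd)))
  let H : space U Y → C(I, space U Y) := lift (fun y => ⟨fun t => inlPt (h (y, t)),
      c0.comp (by fun_prop : Continuous fun t : I => (y, t))⟩)
    (fun i y s => ⟨fun t => conePt i (h (y, t)) (coneHtpy s t),
      (c1 i).comp (by fun_prop : Continuous fun t : I => ((y, s), t))⟩)
    (fun i y => by ext t; simp [kz, conePt_zero])
    (fun i y => by ext t; simp [ko, conePt_one, hp])
    (fun i s => by ext t; simp [hp, conePt_pt])
  have cH : Continuous H := continuous_lift (ContinuousMap.curry ⟨_, c0⟩).continuous
    fun i => (ContinuousMap.curry ⟨_, c1 i⟩).continuous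
  refine ⟨lift v (fun i y s => min (v y) (coneHt s)) (fun i y => ?_) (fun i y => ?_)
    (fun i s => ?_), fun p => H p.1 p.2, continuous_lift hv fun i => ?_,
    ContinuousMap.continuous_uncurry_of_continuous ⟨H, cH⟩, ?_, ?_, ?_, ?_⟩
  · rw [w0]; exact min_eq_left (v y).2.2
  · rw [w1, hvy]; exact min0 _
  · rw [hvy, min_comm]; exact min0 _
  · fun_prop
  · intro z
    constructor
    · induction z using ind with
      | hl y => intro e; exact congrArg _ ((v0 y).1 e)
      | hc i y s =>
        intro e
        change min (v y) (coneHt s) = 0 at e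
        rcases min_choice (v y) (coneHt s) with e' | e'
        · rw [(v0 y).1 (e'.symm.trans e)]; exact conePt_pt i s
        · rw [wz s (e'.symm.trans e)]; exact conePt_one i y
    · rintro rfl
      exact hvy
  · intro z
    induction z using ind with
    | hl y => change inlPt (h (y, 0)) = _; rw [h0]
    | hc i y s => change conePt i (h (y, 0)) (coneHtpy s 0) = _; rw [h0, k0]
  · intro t
    change inlPt (h (Y.pt, t)) = _
    rw [hp]; rfl
  · intro z
    induction z using ind with
    | hl y =>
      intro e
      change inlPt (h (y, 1)) = _
      rw [h1 y e]; rfl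
    | hc i y s =>
      intro e
      change min (v y) (coneHt s) < 1 at e
      change conePt i (h (y, 1)) (coneHtpy s 1) = _
      rcases min_lt_iff.1 e with e | e
      · rw [h1 y e]; exact conePt_pt _ _
      · rw [wl s e]; exact conePt_one _ _

/-- Functoriality of the join in both variables. -/
def map {V : Finset ι} (hUV : U ⊆ V) {Y Z : PtCG.{u}} (f : Y ⟶ Z) : space U Y ⟶ space V Z :=
  PtCG.mkHom
    (lift (fun y => inlPt (f y)) (fun i y s => conePt ⟨i, hUV i.2⟩ (f y) s)
      (fun i y => conePt_zero _ _) (fun i y => by rw [conePt_one, PtCG.apply_pt])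
      (fun i s => by rw [PtCG.apply_pt, conePt_pt]))
    (continuous_lift (continuous_inlPt.comp (PtCG.hom_continuous f))
      fun i => (continuous_conePt _).comp
        (((PtCG.hom_continuous f).comp continuous_fst).prodMk continuous_snd))
    (congrArg inlPt (PtCG.apply_pt f))

/-- The canonical map `X ∧ (U * Y) ⟶ U * (X ∧ Y)`, `x ∧ (i, y, s) ↦ (i, x ∧ y, s)`. -/
def smashComm (X Y : PtCG.{u}) (U : Finset ι) :
    PtCG.smash X (space U Y) ⟶ space U (PtCG.smash X Y) :=
  PtCG.mkHom
    (PtCG.smashLift (fun x => lift (fun y => inlPt (PtCG.smashMk x y))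
        (fun i y s => conePt i (PtCG.smashMk x y) s)
        (fun i y => conePt_zero _ _)
        (fun i y => by rw [conePt_one, PtCG.smashMk_pt_right])
        (fun i s => by rw [PtCG.smashMk_pt_right, conePt_pt]))
      (inlPt (PtCG.smash X Y).pt)
      (fun z => by
        induction z using ind with
        | hl y => exact congrArg inlPt (PtCG.smashMk_pt_left y)
        | hc i y s =>
          exact (congrArg (fun q => conePt i q s) (PtCG.smashMk_pt_left y)).trans
            (conePt_pt i s))
      (fun x => congrArg inlPt (PtCG.smashMk_pt_right x)))
    (PtCG.continuous_smashLift _ _ _ _ (by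
      let g : X × space U Y → space U (PtCG.smash X Y) := fun p =>
        lift (fun y => inlPt (PtCG.smashMk p.1 y)) (fun i y s => conePt i (PtCG.smashMk p.1 y) s)
          (fun i y => conePt_zero _ _)
          (fun i y => by rw [conePt_one, PtCG.smashMk_pt_right])
          (fun i s => by rw [PtCG.smashMk_pt_right, conePt_pt]) p.2
      refine continuous_lift_kprod (isQuotientMap_quot_mk (r := Rel U Y)) (g := g) ?_
      refine continuous_Kify_dom fun K _ _ _ f hf => ?_
      have hm : Continuous fun p : K × Y => PtCG.smashMk (f p.1).1 p.2 :=
        PtCG.continuous_smashMk.comp (continuous_toK (g := fun p : K × Y => ((f p.1).1, p.2))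
          ((hf.fst.comp continuous_fst).prodMk continuous_snd))
      have c0 : Continuous fun p : Y × K => (inlPt (PtCG.smashMk (f p.2).1 p.1) :
          space U (PtCG.smash X Y)) := continuous_inlPt.comp (hm.comp continuous_swap)
      have c1 : ∀ i : U, Continuous fun p : (Y × I) × K =>
          (conePt i (PtCG.smashMk (f p.2).1 p.1.1) p.1.2 : space U (PtCG.smash X Y)) := fun i =>
        (continuous_conePt i).comp ((hm.comp (continuous_snd.prodMk
          (continuous_fst.comp continuous_fst))).prodMk (continuous_snd.comp continuous_fst))
      let G : (Y ⊕ Σ _ : U, Y × I) → C(K, space U (PtCG.smash X Y)) :=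
        Sum.elim (ContinuousMap.curry ⟨_, c0⟩) fun p => ContinuousMap.curry ⟨_, c1 p.1⟩ p.2
      have cG : Continuous G := (ContinuousMap.curry ⟨_, c0⟩).continuous.sumElim
        (continuous_sigma fun i => (ContinuousMap.curry ⟨_, c1 i⟩).continuous)
      have hG : ∀ k p, G p k = g ((f k).1, Quot.mk _ p) := by
        rintro k (y | p) <;> rfl
      exact ((ContinuousMap.continuous_uncurry_of_continuous ⟨G, cG⟩).comp
        (hf.snd.prodMk continuous_id)).congr fun k => hG k (f k).2))
    (congrArg inlPt (PtCG.smashMk_pt_right _))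

end Join

/-- The functor `U * -` on spaces. -/
def joinFunctor {ι : Type} (U : Finset ι) : Sp.{u} ⥤ Sp.{u} where
  obj Y := ⟨Join.space U Y.toPtCG, Join.space_nondegenerate Y.2⟩
  map f := Join.map (Finset.Subset.refl U) f
  map_id Y := PtCG.hom_ext fun z => by
    induction z using Join.ind with
    | hl y => rfl
    | hc i y s => rfl
  map_comp f g := PtCG.hom_ext fun z => by
    induction z using Join.ind with
    | hl y => rfl
    | hc i y s => rfl

/-- The map `U * Y ⟶ V * Y` for `U ⊆ V`. -/
def joinIncl {ι : Type} {U V : Finset ι} (h : U ⊆ V) : joinFunctor.{u} U ⟶ joinFunctor V where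
  app Y := Join.map h (𝟙 Y.toPtCG)
  naturality Y Z f := PtCG.hom_ext fun z => by
    induction z using Join.ind with
    | hl y => rfl
    | hc i y s => rfl

/-- The inclusion `Y ⟶ U * Y`. -/
def joinUnit {ι : Type} (U : Finset ι) : 𝟭 Sp.{u} ⟶ joinFunctor U where
  app Y := PtCG.mkHom (X := Y.toPtCG) (Y := Join.space U Y.toPtCG) Join.inlPt
    Join.continuous_inlPt rfl
  naturality _ _ _ := PtCG.hom_ext fun _ => rfl

/-- The canonical map `X ∧ (U * Y) ⟶ U * (X ∧ Y)`, natural in `Y`. -/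
def smashJoin {ι : Type} (X : Sp.{u}) (U : Finset ι) :
    joinFunctor U ⋙ smashFunctor X ⟶ smashFunctor X ⋙ joinFunctor U where
  app Y := Join.smashComm X.toPtCG Y.toPtCG U
  naturality Y Z f := PtCG.hom_ext fun z => by
    induction z using PtCG.smash_ind with
    | h x w =>
      induction w using Join.ind with
      | hl y => rfl
      | hc i y s => rfl

/-! ## Homotopy limits of punctured cubes -/

/-- The poset of nonempty subsets of `{0, …, n}`, as a category. -/
abbrev Punctured (n : ℕ) : Type := {U : Finset (Fin (n + 1)) // U.Nonempty}

/-- The simplex `Δ^U` on the vertex set `U`, as a face of the standard `n`-simplex. -/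
def simplexFace {n : ℕ} (U : Punctured n) : Set (stdSimplex ℝ (Fin (n + 1))) :=
  {t | ∀ i ∉ U.1, t i = 0}

lemma simplexFace_mono {n : ℕ} {U V : Punctured n} (h : U ⟶ V) : simplexFace U ⊆ simplexFace V :=
  fun _ ht i hi => ht i fun hi' => hi (leOfHom h hi')

namespace Holim

variable {n : ℕ}

/-- Families of maps `Δ^U → D(U)` that are natural in `U`. -/
abbrev Pre (D : Punctured n ⥤ PtCG.{u}) : Type u :=
  {φ : ∀ U : Punctured n, C(simplexFace U, D.obj U) //
    ∀ (U V : Punctured n) (h : U ⟶ V) (t : simplexFace U),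
      φ V ⟨t.1, simplexFace_mono h t.2⟩ = D.map h (φ U t)}

/-- The homotopy limit of a punctured `(n+1)`-cube: the space of natural families of maps
`Δ^U → D(U)`. As `Δ^U` is (by barycentric subdivision) the realization of the nerve of the poset of
nonempty subsets of `U`, this is the usual model as a space of maps from the nerves of the
over-categories. -/
def space (D : Punctured n ⥤ PtCG.{u}) : PtCG.{u} where
  carrier := Kify (Pre D)
  pt := toK ⟨fun _ => ContinuousMap.const _ (PtCG.pt _), fun _ _ _ _ => (PtCG.apply_pt _).symm⟩

/-- Functoriality of the homotopy limit before refining the topology. -/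
def preMap {D E : Punctured n ⥤ PtCG.{u}} (α : D ⟶ E) (φ : Pre D) : Pre E :=
  ⟨fun U => (α.app U).hom.comp (φ.1 U), fun U V h t =>
    (congrArg (α.app V).hom (φ.2 U V h t)).trans (PtCG.congr_apply (α.naturality h) (φ.1 U t))⟩

lemma continuous_preMap {D E : Punctured n ⥤ PtCG.{u}} (α : D ⟶ E) : Continuous (preMap α) :=
  Continuous.subtype_mk (f := fun φ : Pre D => fun U => (α.app U).hom.comp (φ.1 U))
    (continuous_pi fun U => (ContinuousMap.continuous_postcomp _).comp
      ((continuous_apply U).comp continuous_subtype_val)) _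

/-- The homotopy limit as a functor. -/
def functor : (Punctured n ⥤ PtCG.{u}) ⥤ PtCG.{u} where
  obj D := space D
  map {D E} α := PtCG.mkHom (X := space D) (Y := space E) (fun φ => toK (preMap α (ofK φ)))
    (continuous_Kify_map (continuous_preMap α))
    (Subtype.ext (funext fun U => ContinuousMap.ext fun _ => PtCG.apply_pt (α.app U)))
  map_id _ := rfl
  map_comp _ _ := rfl

/-- The map into the homotopy limit, by constant families, from a space over the diagram. -/
def lift {D : Punctured n ⥤ PtCG.{u}} {Z : PtCG.{u}} (f : ∀ U, Z ⟶ D.obj U)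
    (hf : ∀ (U V : Punctured n) (h : U ⟶ V), f U ≫ D.map h = f V) : Z ⟶ space D :=
  PtCG.mkHom (Y := space D)
    (fun z => toK ⟨fun U => ContinuousMap.const _ (f U z), fun U V h _ =>
      (PtCG.congr_apply (hf U V h) z).symm⟩)
    (continuous_toK (Continuous.subtype_mk (continuous_pi fun U =>
      ContinuousMap.continuous_const'.comp (PtCG.hom_continuous (f U))) _))
    (Subtype.ext (funext fun U => ContinuousMap.ext fun _ => PtCG.apply_pt (f U)))

end Holim

/-! ## Goodwillie's construction -/

/-- The punctured cube `U ↦ U * Y`, functorially in `Y`. -/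
def joinCube (n : ℕ) : Sp.{u} ⥤ (Punctured n ⥤ Sp.{u}) where
  obj Y :=
    { obj := fun U => (joinFunctor U.1).obj Y
      map := fun h => (joinIncl (leOfHom h)).app Y
      map_id := fun U => PtCG.hom_ext fun z => by
        induction z using Join.ind with
        | hl y => rfl
        | hc i y s => rfl
      map_comp := fun f g => PtCG.hom_ext fun z => by
        induction z using Join.ind with
        | hl y => rfl
        | hc i y s => rfl }
  map f :=
    { app := fun U => (joinFunctor U.1).map f
      naturality := fun U V h => ((joinIncl (leOfHom h)).naturality f).symm }
  map_id Y := by ext U; exact (joinFunctor U.1).map_id Y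
  map_comp f g := by ext U; exact (joinFunctor U.1).map_comp f g

/-- `T_n F (Y) = holim_{∅ ≠ U ⊆ {0, …, n}} F(U * Y)`. -/
def T (n : ℕ) (F : Sp.{u} ⥤ PtCG.{u}) : Sp.{u} ⥤ PtCG.{u} :=
  joinCube n ⋙ (Functor.whiskeringRight _ _ _).obj F ⋙ Holim.functor

/-- `T_n` on natural transformations. -/
def Tmap (n : ℕ) {F G : Sp.{u} ⥤ PtCG.{u}} (α : F ⟶ G) : T n F ⟶ T n G :=
  Functor.whiskerLeft (joinCube n)
    (Functor.whiskerRight ((Functor.whiskeringRight _ _ _).map α) Holim.functor)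

/-- The natural map `t_n F : F ⟶ T_n F`, induced by the maps `Y ⟶ U * Y`. -/
def t (n : ℕ) (F : Sp.{u} ⥤ PtCG.{u}) : F ⟶ T n F where
  app Y := Holim.lift (D := (joinCube n).obj Y ⋙ F) (fun U => F.map ((joinUnit U.1).app Y))
    fun _ _ _ => (F.map_comp _ _).symm.trans (congrArg (fun g => F.map g) rfl)
  naturality Y Z f := PtCG.hom_ext fun z => Subtype.ext (funext fun U => ContinuousMap.ext fun _ =>
    PtCG.congr_apply (show F.map f ≫ F.map ((joinUnit U.1).app Z) =
        F.map ((joinUnit U.1).app Y) ≫ F.map ((joinFunctor U.1).map f) from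
      (F.map_comp _ _).symm.trans ((congrArg (fun g => F.map g)
        ((joinUnit U.1).naturality f)).trans (F.map_comp _ _))) z)

lemma t_Tmap (n : ℕ) {F G : Sp.{u} ⥤ PtCG.{u}} (α : F ⟶ G) : t n F ≫ Tmap n α = α ≫ t n G := by
  ext Y
  exact PtCG.hom_ext fun z => Subtype.ext (funext fun U => ContinuousMap.ext fun _ =>
    PtCG.congr_apply (α.naturality ((joinUnit U.1).app Y)) z)

/-- The `k`-fold iterate `T_n^k F`. -/
def Titer (n : ℕ) (F : Sp.{u} ⥤ PtCG.{u}) : ℕ → (Sp.{u} ⥤ PtCG.{u})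
  | 0 => F
  | k + 1 => T n (Titer n F k)

/-- `T_n^k` on natural transformations. -/
def TiterMap (n : ℕ) {F G : Sp.{u} ⥤ PtCG.{u}} (α : F ⟶ G) : ∀ k, Titer n F k ⟶ Titer n G k
  | 0 => α
  | k + 1 => Tmap n (TiterMap n α k)

/-! ## Mapping telescopes -/

namespace Telescope

/-- The end of the `k`-th cylinder is glued to the start of the next one. -/
inductive Rel (X : ℕ → PtCG.{u}) (f : ∀ k, X k ⟶ X (k + 1)) :
    (Σ k : ℕ, X k × I) → (Σ k : ℕ, X k × I) → Prop
  | glue (k : ℕ) (x : X k) : Rel X f ⟨k, x, 1⟩ ⟨k + 1, f k x, 0⟩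

/-- The mapping telescope of a sequence `X_0 ⟶ X_1 ⟶ ⋯`, its sequential homotopy colimit, with the
basepoint of `X_0` as basepoint. -/
def space (X : ℕ → PtCG.{u}) (f : ∀ k, X k ⟶ X (k + 1)) : PtCG.{u} where
  carrier := Quot (Rel X f)
  pt := Quot.mk _ ⟨0, (X 0).pt, 0⟩

lemma mk_congr {X : ℕ → PtCG.{u}} {f : ∀ k, X k ⟶ X (k + 1)} (k : ℕ) {x x' : X k} (h : x = x')
    (s : I) : (Quot.mk _ ⟨k, x, s⟩ : Quot (Rel X f)) = Quot.mk _ ⟨k, x', s⟩ := by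
  rw [h]

/-- The map of telescopes induced by a map of sequences. -/
def map {X Y : ℕ → PtCG.{u}} {f : ∀ k, X k ⟶ X (k + 1)} {g : ∀ k, Y k ⟶ Y (k + 1)}
    (α : ∀ k, X k ⟶ Y k) (h : ∀ k, f k ≫ α (k + 1) = α k ≫ g k) : space X f ⟶ space Y g :=
  PtCG.mkHom (X := space X f) (Y := space Y g)
    (Quot.map (fun p => ⟨p.1, α p.1 p.2.1, p.2.2⟩) (by
      rintro _ _ ⟨k, x⟩
      have e : α (k + 1) (f k x) = g k (α k x) := PtCG.congr_apply (h k) x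
      dsimp only
      rw [e]
      exact .glue k _))
    (continuous_quot_lift _ (continuous_quot_mk.comp (continuous_sigma fun k =>
      (@continuous_sigmaMk ℕ (fun k => Y k × I) _ k).comp
        (((PtCG.hom_continuous (α k)).comp continuous_fst).prodMk continuous_snd))))
    (mk_congr 0 (PtCG.apply_pt (α 0)) 0)

end Telescope

/-- Goodwillie's `n`-excisive approximation `P_n F`, the homotopy colimit of
`F ⟶ T_n F ⟶ T_n T_n F ⟶ ⋯`. -/
def P (n : ℕ) (F : Sp.{u} ⥤ PtCG.{u}) : Sp.{u} ⥤ PtCG.{u} where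
  obj Y := Telescope.space (fun k => (Titer n F k).obj Y) (fun k => (t n (Titer n F k)).app Y)
  map f := Telescope.map (fun k => (Titer n F k).map f)
    (fun k => ((t n (Titer n F k)).naturality f).symm)
  map_id Y := PtCG.hom_ext fun z => by
    induction z using Quot.ind with
    | mk p =>
      exact Telescope.mk_congr p.1 (PtCG.congr_apply ((Titer n F p.1).map_id Y) p.2.1) p.2.2
  map_comp f g := PtCG.hom_ext fun z => by
    induction z using Quot.ind with
    | mk p =>
      exact Telescope.mk_congr p.1 (PtCG.congr_apply ((Titer n F p.1).map_comp f g) p.2.1) p.2.2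

/-- Natural transformations compatible with the maps `t_n` at every stage induce a map of telescopes;
`S` is a functor precomposed to the second tower. -/
def Pmap' (n : ℕ) {F G : Sp.{u} ⥤ PtCG.{u}} (S : Sp.{u} ⥤ Sp.{u})
    (α : ∀ k, Titer n F k ⟶ S ⋙ Titer n G k)
    (h : ∀ k, t n (Titer n F k) ≫ α (k + 1) = α k ≫ Functor.whiskerLeft S (t n (Titer n G k))) :
    P n F ⟶ S ⋙ P n G where
  app Y := Telescope.map (fun k => (α k).app Y) (fun k => NatTrans.congr_app (h k) Y)
  naturality Y Z f := PtCG.hom_ext fun z => by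
    induction z using Quot.ind with
    | mk p =>
      exact Telescope.mk_congr p.1 (PtCG.congr_apply ((α p.1).naturality f) p.2.1) p.2.2

/-- `P_n` on natural transformations. -/
def Pmap (n : ℕ) {F G : Sp.{u} ⥤ PtCG.{u}} (α : F ⟶ G) : P n F ⟶ P n G :=
  Pmap' n (𝟭 _) (fun k => TiterMap n α k) (fun k => t_Tmap n (TiterMap n α k))

/-! ## Shifting and `P_n` -/

/-- The canonical map `T_n (F_X) ⟶ (T_n F)_X`, induced by `X ∧ (U * Y) ⟶ U * (X ∧ Y)`. -/
def shiftT (n : ℕ) (X : Sp.{u}) (F : Sp.{u} ⥤ PtCG.{u}) : T n (shift X F) ⟶ shift X (T n F) where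
  app Y := Holim.functor.map
    (X := (joinCube n).obj Y ⋙ shift X F) (Y := (joinCube n).obj ((smashFunctor X).obj Y) ⋙ F)
    { app := fun U => F.map ((smashJoin X U.1).app Y)
      naturality := fun U V h => (F.map_comp _ _).symm.trans
        ((congrArg (fun g => F.map g) (PtCG.hom_ext fun z => by
          induction z using PtCG.smash_ind with
          | h x w =>
            induction w using Join.ind with
            | hl y => rfl
            | hc i y s => rfl)).trans (F.map_comp _ _)) }
  naturality Y Z f := (Holim.functor.map_comp _ _).symm.trans
    ((congrArg (fun g => Holim.functor.map g) (by
      ext U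
      exact (F.map_comp _ _).symm.trans
        ((congrArg (fun g => F.map g) ((smashJoin X U.1).naturality f)).trans
          (F.map_comp _ _)))).trans (Holim.functor.map_comp _ _))

lemma t_shiftT (n : ℕ) (X : Sp.{u}) (F : Sp.{u} ⥤ PtCG.{u}) :
    t n (shift X F) ≫ shiftT n X F = Functor.whiskerLeft (smashFunctor X) (t n F) := by
  ext Y
  exact PtCG.hom_ext fun z => Subtype.ext (funext fun U => ContinuousMap.ext fun _ =>
    PtCG.congr_apply ((F.map_comp _ _).symm.trans (congrArg (fun g => F.map g)
      (PtCG.hom_ext fun z => by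
        induction z using PtCG.smash_ind with
        | h x w => rfl))) z)

/-- The canonical map `T_n^k (F_X) ⟶ (T_n^k F)_X`. -/
def shiftTiter (n : ℕ) (X : Sp.{u}) (F : Sp.{u} ⥤ PtCG.{u}) :
    ∀ k, Titer n (shift X F) k ⟶ shift X (Titer n F k)
  | 0 => 𝟙 _
  | k + 1 => Tmap n (shiftTiter n X F k) ≫ shiftT n X (Titer n F k)

/-- The canonical map `P_n (F_X) ⟶ (P_n F)_X`. -/
def shiftP (n : ℕ) (X : Sp.{u}) (F : Sp.{u} ⥤ PtCG.{u}) : P n (shift X F) ⟶ shift X (P n F) :=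
  Pmap' n (smashFunctor X) (shiftTiter n X F) fun k => by
    change t n _ ≫ Tmap n _ ≫ shiftT n X _ = _
    rw [← Category.assoc, t_Tmap, Category.assoc, t_shiftT]
    rfl

/-- The canonical homeomorphism `X ∧ S⁰ ⟶ X`. -/
def smashSphere (X : Sp.{u}) : (smashFunctor X).obj sphereZero ⟶ X :=
  PtCG.mkHom (X := PtCG.smash X.toPtCG (finSp 1).toPtCG) (Y := X.toPtCG)
    (PtCG.smashLift (fun x (i : ULift (Fin 2)) => if i = ⟨0⟩ then X.pt else x) X.pt
      (fun y => ite_self _) (fun x => if_pos rfl))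
    (PtCG.continuous_smashLift _ _ _ _ (by
      have h : Continuous fun p : X × ULift.{u} (Fin 2) => if p.2 = ⟨0⟩ then X.pt else p.1 :=
        continuous_prod_of_discrete_right.2 fun i => by
          by_cases hi : i = ⟨0⟩ <;> simp only [hi, if_true, if_false] <;> fun_prop
      exact h.comp continuous_ofK))
    (show (if (⟨0⟩ : ULift.{u} (Fin 2)) = ⟨0⟩ then X.pt else X.pt) = X.pt from if_pos rfl)

/-! ## The algebraic Goodwillie approximation -/

/-- The algebraic Goodwillie approximation `P_n^alg F(X) = P_n (L F_X) (S⁰)`. -/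
def Palg (n : ℕ) (F : Sp.{u} ⥤ PtCG.{u}) (X : Sp.{u}) : PtCG.{u} :=
  (P n (leftKan (shift X F))).obj sphereZero

/-- The natural map `P_n^alg F(X) ⟶ P_n F(X)`: the map `P_n (L F_X) (S⁰) ⟶ P_n (F_X) (S⁰)` induced by
`L F_X ⟶ F_X`, followed by the identification `P_n (F_X) (S⁰) ≅ P_n F(X ∧ S⁰) ≅ P_n F(X)`. -/
def palgToP (n : ℕ) (F : Sp.{u} ⥤ PtCG.{u}) (hF : IsContinuousFunctor F) (X : Sp.{u}) :
    Palg n F X ⟶ (P n F).obj X :=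
  (Pmap n (leftKanCounit (shift X F) (hF.shift X))).app sphereZero ≫
    (shiftP n X F).app sphereZero ≫ (P n F).map (smashSphere X)

end AlgGoodwillie

/-!
Weak equivalences of pointed spaces are characterized by the homotopy extension and lifting property
(`HELP`) for the pairs `(I^k, ∂I^k)`: see `isWeakEquiv_iff_help`. No cofibrancy or separation
assumption on the spaces is needed for this, as the proof only uses homotopies of maps out of cubes.
The key fact is that solvability of a lifting problem over `(I^k, ∂I^k)` depends only on the homotopy
class of the problem (`Solvable.of_homotopy`), since every map has the property for horns.

With this characterization, both constructions in the definition of `P_n` preserve objectwise weak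
equivalences.

* A point of the homotopy limit of a punctured cube is a natural family of maps `Δ^U → D(U)`. A
  lifting problem for homotopy limits is solved by induction over the faces of the simplex: the step
  at `U` is a lifting problem over `(I^k, ∂I^k) × (Δ^U, ∂Δ^U)`, a pair homeomorphic to a cube and its
  boundary (`HELP.cube_prod_simplexFace`, `isWeakEquiv_holimMap`).
* A lifting problem for mapping telescopes has bounded height by compactness. Sliding it up the
  telescope is a homotopy of problems, and moves it to a single stage (`Telescope.isWeakEquiv_map`).

Hence `P_n` turns the objectwise weak equivalence `L F_X ⟶ F_X` into a weak equivalence. The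
identification `P_n (F_X) (S⁰) ⟶ P_n F(X)` is a weak equivalence as well, for it is built by the same
constructions from the homeomorphisms `X ∧ (U * Y) ≅ U * (X ∧ Y)` and `X ∧ S⁰ ≅ X`.
-/

open Set

namespace AlgGoodwillie

/-! ### Lifting problems up to homotopy -/

section Lifting

variable {X Y Z W : Type*} [TopologicalSpace X] [TopologicalSpace Y] [TopologicalSpace Z]
  [TopologicalSpace W]

/-- A homotopy lifting problem for `f : X → Y` over the pair `A ⊆ B`: a map `a : A → X`, a map
`b : B → Y` and a homotopy `H` on `A` from `f ∘ a` to `b`. All maps are total functions on the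
ambient space `Z`, and only their restrictions to `A` and `B` matter. -/
structure LiftingProblem (f : X → Y) (B A : Set Z) (a : Z → X) (b : Z → Y) (H : Z × I → Y) :
    Prop where
  cont_a : ContinuousOn a A
  cont_b : ContinuousOn b B
  cont_H : ContinuousOn H (A ×ˢ univ)
  H_zero : ∀ z ∈ A, H (z, 0) = f (a z)
  H_one : ∀ z ∈ A, H (z, 1) = b z

/-- A solution of a lifting problem over `A ⊆ B` extends `a` and `H` from `A` to `B`. -/
def Solvable (f : X → Y) (B A : Set Z) (a : Z → X) (b : Z → Y) (H : Z × I → Y) : Prop :=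
  ∃ a' H', LiftingProblem f B B a' b H' ∧ EqOn a' a A ∧ EqOn H' H (A ×ˢ univ)

/-- `f` has the homotopy extension and lifting property for the pair `A ⊆ B`. -/
def HELP (f : X → Y) (B A : Set Z) : Prop :=
  ∀ a b H, LiftingProblem f B A a b H → Solvable f B A a b H

/-- The homotopy extension and lifting property passes to retracts of pairs. -/
lemma HELP.retract {f : X → Y} {B A : Set Z} {B' A' : Set W} (h : HELP f B' A') (hA : A ⊆ B)
    {i : Z → W} {r : W → Z} (ci : ContinuousOn i B) (cr : ContinuousOn r B')
    (iB : MapsTo i B B') (iA : MapsTo i A A') (rB : MapsTo r B' B) (rA : MapsTo r A' A)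
    (hA' : A' ⊆ B') (hri : ∀ z ∈ B, r (i z) = z) : HELP f B A := by
  intro a b H hp
  have cr' : ContinuousOn (fun p : W × I => (r p.1, p.2)) (B' ×ˢ univ) :=
    (cr.comp continuousOn_fst fun p hp => hp.1).prodMk continuousOn_snd
  have ci' : ContinuousOn (fun p : Z × I => (i p.1, p.2)) (B ×ˢ univ) :=
    (ci.comp continuousOn_fst fun p hp => hp.1).prodMk continuousOn_snd
  obtain ⟨a', H', hp', ha, hH⟩ := h (a ∘ r) (b ∘ r) (fun p => H (r p.1, p.2))
    ⟨hp.cont_a.comp (cr.mono hA') rA, hp.cont_b.comp cr rB,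
      hp.cont_H.comp (cr'.mono (prod_mono hA' le_rfl)) fun p hp => ⟨rA hp.1, trivial⟩,
      fun z hz => hp.H_zero _ (rA hz), fun z hz => hp.H_one _ (rA hz)⟩
  refine ⟨a' ∘ i, fun p => H' (i p.1, p.2), ⟨hp'.cont_a.comp ci iB, hp.cont_b,
    hp'.cont_H.comp ci' fun p hp => ⟨iB hp.1, trivial⟩, fun z hz => hp'.H_zero _ (iB hz),
    fun z hz => ?_⟩, fun z hz => ?_, fun p hp => ?_⟩
  · rw [hp'.H_one _ (iB hz)]
    simp [hri z hz]
  · simp [ha (iA hz), hri z (hA hz)]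
  · refine (hH (x := (i p.1, p.2)) ⟨iA hp.1, trivial⟩).trans ?_
    simp [hri _ (hA hp.1)]

/-- Every map has the homotopy extension and lifting property for the pair `Z × {0} ⊆ Z × I`: the
square with one side removed retracts to the path made of two sides, here parametrized by
`t * (1 + s) ∈ [0, 2]`. -/
lemma help_cylinder (f : X → Y) : HELP f (univ : Set (Z × I)) {p | p.2 = 0} := by
  intro a b H hp
  let pr : ℝ → I := projIcc 0 1 zero_le_one
  have cpr : Continuous pr := continuous_projIcc
  let l : (Z × I) × I → ℝ := fun p => p.2 * (1 + p.1.2)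
  have cl : Continuous l := by fun_prop
  have cb : Continuous b := continuousOn_univ.1 hp.cont_b
  have ca : Continuous fun p : Z × I => a (p.1, 0) :=
    hp.cont_a.comp_continuous (by fun_prop) fun _ => rfl
  have cH : Continuous fun p : (Z × I) × I => H ((p.1.1, 0), pr (l p)) :=
    hp.cont_H.comp_continuous (by fun_prop) fun _ => ⟨rfl, trivial⟩
  have pr1 : ∀ x : ℝ, 1 ≤ x → pr x = 1 := fun x hx => projIcc_of_right_le _ hx
  have pr0 : ∀ x : ℝ, x ≤ 0 → pr x = 0 := fun x hx => projIcc_of_le_left _ hx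
  refine ⟨fun p => a (p.1, 0),
    fun p => if l p ≤ 1 then H ((p.1.1, 0), pr (l p)) else b (p.1.1, pr (l p - 1)),
    ⟨ca.continuousOn, hp.cont_b, ?_, ?_, ?_⟩, ?_, ?_⟩
  · refine (Continuous.if_le cH (by fun_prop) cl continuous_const ?_).continuousOn
    intro p h
    rw [pr1 _ h.ge, pr0 _ (by rw [h, sub_self]), hp.H_one _ rfl]
  · rintro ⟨z, s⟩ -
    have h : l ((z, s), 0) = 0 := by simp [l]
    simp only [h]
    rw [if_pos zero_le_one, pr0 _ le_rfl, hp.H_zero _ rfl]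
  · rintro ⟨z, s⟩ -
    have h : l ((z, s), 1) = 1 + s := by simp [l]
    simp only [h]
    split_ifs with h1
    · have hs : s = 0 := Subtype.ext (le_antisymm (by simpa using h1) s.2.1)
      rw [pr1 _ (by rw [hs]; simp), hp.H_one _ rfl, hs]
    · simp [pr, projIcc_val]
  · rintro ⟨z, s⟩ (rfl : s = 0)
    rfl
  · rintro ⟨⟨z, s⟩, t⟩ ⟨(rfl : s = 0), -⟩
    have h : l ((z, 0), t) = t := by simp [l]
    simp only [h]
    rw [if_pos t.2.2]
    simp [pr, projIcc_val]

/-! ### Horns in cubes -/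

/-- The horn in `I^ι × I`: all faces but the one opposite to `s = j`, for `j = 0` or `j = 1`. -/
def horn (ι : Type*) (j : I) : Set ((ι → I) × I) := {w | w.1 ∈ Cube.boundary ι ∨ w.2 = j}

variable {ι : Type*} [Fintype ι]

lemma isClosed_boundary : IsClosed (Cube.boundary ι) := by
  have : Cube.boundary ι = ⋃ i, {y : ι → I | y i = 0 ∨ y i = 1} := by
    ext y; simp [Cube.boundary]
  rw [this]
  exact isClosed_iUnion_of_finite fun i =>
    (isClosed_eq (continuous_apply i) continuous_const).union
      (isClosed_eq (continuous_apply i) continuous_const)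

lemma isClosed_horn (j : I) : IsClosed (horn ι j) :=
  (isClosed_boundary.preimage continuous_fst).union (isClosed_eq continuous_snd continuous_const)

/-- Radial projection from a point opposite to the horn exhibits the cube and its horn as a retract
of a cylinder and its base. -/
lemma exists_horn_zero_retract : ∃ (u : (ι → I) × I → I) (r : ((ι → I) × I) × I → (ι → I) × I),
    Continuous u ∧ Continuous r ∧ (∀ w ∈ horn ι 0, u w = 0) ∧ (∀ w, r (w, 0) ∈ horn ι 0) ∧
    ∀ w, r (w, u w) = w := by
  let pr : ℝ → I := projIcc 0 1 zero_le_one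
  have cpr : Continuous pr := continuous_projIcc
  -- Center the cube at the origin; the projection is from the point at height `2` above it.
  let c : (ι → I) → ι → ℝ := fun y i => 2 * (y i : ℝ) - 1
  have cc : Continuous c := by fun_prop
  let M : (ι → I) × I → ℝ := fun w => max ‖c w.1‖ ((2 - (w.2 : ℝ)) / 2)
  have cM : Continuous M := by fun_prop
  have cle : ∀ y i, |c y i| ≤ 1 := fun y i => by
    have h0 := (y i).2.1
    have h1 := (y i).2.2
    simp only [c]
    exact abs_le.2 ⟨by linarith, by linarith⟩
  have M1 : ∀ w, M w ≤ 1 := fun w => max_le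
    ((pi_norm_le_iff_of_nonneg zero_le_one).2 fun i => cle _ i) (by linarith [w.2.2.1])
  have M0 : ∀ w, 1 / 2 ≤ M w := fun w => le_max_of_le_right (by linarith [w.2.2.2])
  have Mp : ∀ w, M w ≠ 0 := fun w => by linarith [M0 w]
  refine ⟨fun w => pr (1 - M w), fun p => (fun i => pr ((1 + (1 - p.2) * (c p.1.1 i / M p.1)) / 2),
    pr (2 - (1 - p.2) * ((2 - p.1.2) / M p.1))), by fun_prop, ?_, ?_, ?_, ?_⟩
  · have cM' : Continuous fun p : ((ι → I) × I) × I => M p.1 := by fun_prop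
    have cc' : ∀ i, Continuous fun p : ((ι → I) × I) × I => c p.1.1 i := fun i => by fun_prop
    refine (continuous_pi fun i => cpr.comp ?_).prodMk (cpr.comp ?_)
    · exact (continuous_const.add ((continuous_const.sub (continuous_subtype_val.comp
        continuous_snd)).mul ((cc' i).div cM' fun p => Mp p.1))).div_const 2
    · have : Continuous fun p : ((ι → I) × I) × I => (2 - (p.1.2 : ℝ)) / M p.1 :=
        Continuous.div (by fun_prop) cM' fun p => Mp p.1
      fun_prop
  · intro w hw
    have : 1 ≤ M w := by
      rcases hw with ⟨i, hi⟩ | hw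
      · refine le_max_of_le_left (le_trans ?_ (norm_le_pi_norm (c w.1) i))
        rcases hi with hi | hi <;> norm_num [c, hi]
      · exact le_max_of_le_right (by simp [hw])
    exact projIcc_of_le_left _ (by linarith)
  · intro w
    rcases max_choice ‖c w.1‖ ((2 - (w.2 : ℝ)) / 2) with h | h
    · left
      have hM : M w = ‖c w.1‖ := h
      have hne : (Finset.univ : Finset ι).Nonempty := by
        by_contra hne
        rw [Finset.not_nonempty_iff_eq_empty, Finset.univ_eq_empty_iff] at hne
        have : ‖c w.1‖ = 0 := by
          rw [Subsingleton.elim (c w.1) 0, norm_zero]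
        exact Mp w (hM.trans this)
      obtain ⟨i, -, hi⟩ := Finset.exists_max_image Finset.univ (fun i => ‖c w.1 i‖) hne
      have hi' : |c w.1 i| = M w := by
        rw [hM]
        exact le_antisymm (norm_le_pi_norm (c w.1) i)
          ((pi_norm_le_iff_of_nonneg (norm_nonneg _)).2 fun j => hi j (Finset.mem_univ j))
      refine ⟨i, ?_⟩
      have hd : |c w.1 i / M w| = 1 := by
        rw [abs_div, hi', abs_of_pos (by linarith [M0 w]), div_self (Mp w)]
      rcases eq_or_eq_neg_of_abs_eq hd with e | e
      · right
        exact projIcc_of_right_le zero_le_one (by rw [e]; norm_num)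
      · left
        exact projIcc_of_le_left zero_le_one (by rw [e]; norm_num)
    · right
      have hM : M w = (2 - (w.2 : ℝ)) / 2 := h
      refine projIcc_of_le_left zero_le_one ?_
      have : (2 - (w.2 : ℝ)) / M w = 2 := by
        rw [hM]
        have : (2 : ℝ) - w.2 ≠ 0 := by linarith [w.2.2.2]
        field_simp
      simp [this]
  · intro w
    have hu : ((pr (1 - M w) : I) : ℝ) = 1 - M w :=
      congrArg Subtype.val (projIcc_of_mem zero_le_one ⟨by linarith [M1 w], by linarith [M0 w]⟩)
    refine Prod.ext (funext fun i => ?_) ?_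
    · simp only [hu]
      have : (1 + (1 - (1 - M w)) * (c w.1 i / M w)) / 2 = w.1 i := by
        have := Mp w
        field_simp
        simp only [c]
        ring
      rw [this]
      exact projIcc_val zero_le_one _
    · simp only [hu]
      have : 2 - (1 - (1 - M w)) * ((2 - (w.2 : ℝ)) / M w) = w.2 := by
        have := Mp w
        field_simp
        ring
      rw [this]
      exact projIcc_val zero_le_one _

lemma exists_horn_retract {j : I} (hj : j = 0 ∨ j = 1) :
    ∃ (u : (ι → I) × I → I) (r : ((ι → I) × I) × I → (ι → I) × I),
    Continuous u ∧ Continuous r ∧ (∀ w ∈ horn ι j, u w = 0) ∧ (∀ w, r (w, 0) ∈ horn ι j) ∧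
    ∀ w, r (w, u w) = w := by
  obtain ⟨u, r, cu, cr, hu, hr, hru⟩ := exists_horn_zero_retract (ι := ι)
  rcases hj with rfl | rfl
  · exact ⟨u, r, cu, cr, hu, hr, hru⟩
  · let φ : (ι → I) × I → (ι → I) × I := fun w => (w.1, σ w.2)
    have cφ : Continuous φ := by fun_prop
    have h1 : ∀ w ∈ horn ι 1, φ w ∈ horn ι 0 := by
      rintro w (hw | hw)
      · exact Or.inl hw
      · exact Or.inr (by simp [φ, hw])
    have h0 : ∀ w ∈ horn ι 0, φ w ∈ horn ι 1 := by
      rintro w (hw | hw)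
      · exact Or.inl hw
      · exact Or.inr (by simp [φ, hw])
    refine ⟨fun w => u (φ w), fun p => φ (r (φ p.1, p.2)), by fun_prop, by fun_prop,
      fun w hw => hu _ (h1 w hw), fun w => h0 _ (hr _), fun w => ?_⟩
    simp [hru, φ]

/-- Every map has the homotopy extension and lifting property for horns. -/
lemma help_horn (f : X → Y) {j : I} (hj : j = 0 ∨ j = 1) : HELP f univ (horn ι j) := by
  obtain ⟨u, r, cu, cr, hu, hr, hru⟩ := exists_horn_retract (ι := ι) hj
  refine (help_cylinder (Z := (ι → I) × I) f).retract (subset_univ _)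
    (i := fun w => (w, u w)) (r := r) (by fun_prop) (by fun_prop) (mapsTo_univ _ _)
    hu (mapsTo_univ _ _) ?_ (subset_univ _) fun w _ => hru w
  rintro ⟨w, s⟩ (rfl : s = 0)
  exact hr w

/-- The cube retracts onto its horns. -/
lemma exists_horn_retraction {j : I} (hj : j = 0 ∨ j = 1) :
    ∃ r : (ι → I) × I → (ι → I) × I,
      Continuous r ∧ (∀ w, r w ∈ horn ι j) ∧ ∀ w ∈ horn ι j, r w = w := by
  obtain ⟨u, r, cu, cr, hu, hr, hru⟩ := exists_horn_retract (ι := ι) hj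
  refine ⟨fun w => r (w, 0), by fun_prop, hr, fun w hw => ?_⟩
  have := hru w
  rwa [hu w hw] at this

/-- The homotopy extension property of the pair `∂I^ι ⊆ I^ι`. -/
lemma exists_homotopy_extension {g : (ι → I) → Y} (hg : Continuous g) {h : (ι → I) × I → Y}
    (hh : ContinuousOn h (Cube.boundary ι ×ˢ univ)) (h0 : ∀ y ∈ Cube.boundary ι, h (y, 0) = g y) :
    ∃ h' : (ι → I) × I → Y, Continuous h' ∧ (∀ y, h' (y, 0) = g y) ∧
      EqOn h' h (Cube.boundary ι ×ˢ univ) := by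
  classical
  obtain ⟨r, cr, hr, hr'⟩ := exists_horn_retraction (ι := ι) (j := 0) (Or.inl rfl)
  let k : (ι → I) × I → Y := fun w => if w.2 = 0 then g w.1 else h w
  have k0 : ∀ w : (ι → I) × I, w.2 = 0 → k w = g w.1 := fun w hw => if_pos hw
  have k1 : EqOn k h (Cube.boundary ι ×ˢ univ) := by
    rintro ⟨y, s⟩ ⟨hy, -⟩
    by_cases hs : s = 0
    · subst hs
      rw [k0 _ rfl, h0 y hy]
    · exact if_neg hs
  have ck : ContinuousOn k (horn ι 0) := by
    have : horn ι 0 = Cube.boundary ι ×ˢ univ ∪ {w | w.2 = 0} := by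
      ext w; simp [horn]
    rw [this]
    refine ContinuousOn.union_of_isClosed (hh.congr k1)
      ((hg.comp continuous_fst).continuousOn.congr fun w hw => k0 w hw)
      (isClosed_boundary.prod isClosed_univ) (isClosed_eq continuous_snd continuous_const)
  refine ⟨k ∘ r, ck.comp_continuous cr hr, fun y => ?_, fun w hw => ?_⟩
  · simp [hr' (y, 0) (Or.inr rfl), k0]
  · simp [hr' w (Or.inl hw.1), k1 hw]

/-- Solvability of lifting problems over `∂I^ι ⊆ I^ι` is invariant under homotopies of problems. -/
lemma Solvable.of_homotopy {f : X → Y} {α : (ι → I) × I → X} {β : (ι → I) × I → Y}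
    {η : ((ι → I) × I) × I → Y}
    (hp : LiftingProblem f univ (Cube.boundary ι ×ˢ univ) α β η)
    (h : Solvable f univ (Cube.boundary ι) (fun z => α (z, 1)) (fun z => β (z, 1))
      (fun p => η ((p.1, 1), p.2))) :
    Solvable f univ (Cube.boundary ι) (fun z => α (z, 0)) (fun z => β (z, 0))
      (fun p => η ((p.1, 0), p.2)) := by
  classical
  obtain ⟨a', H', hp', ha, hH⟩ := h
  have hhorn : horn ι 1 = Cube.boundary ι ×ˢ univ ∪ {w | w.2 = 1} := by
    ext w; simp [horn]
  let α' : (ι → I) × I → X := fun w => if w.2 = 1 then a' w.1 else α w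
  have α1 : ∀ w : (ι → I) × I, w.2 = 1 → α' w = a' w.1 := fun w hw => if_pos hw
  have α0 : EqOn α' α (Cube.boundary ι ×ˢ univ) := by
    rintro ⟨y, s⟩ ⟨hy, -⟩
    by_cases hs : s = 1
    · subst hs
      rw [α1 _ rfl]
      exact ha hy
    · exact if_neg hs
  let η' : ((ι → I) × I) × I → Y := fun w => if w.1.2 = 1 then H' (w.1.1, w.2) else η w
  have η1 : ∀ w : ((ι → I) × I) × I, w.1.2 = 1 → η' w = H' (w.1.1, w.2) := fun w hw => if_pos hw
  have η0 : EqOn η' η ((Cube.boundary ι ×ˢ univ) ×ˢ univ) := by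
    rintro ⟨⟨y, s⟩, t⟩ ⟨⟨hy, -⟩, -⟩
    by_cases hs : s = 1
    · subst hs
      rw [η1 _ rfl]
      exact hH ⟨hy, trivial⟩
    · exact if_neg hs
  have cl0 : IsClosed (Cube.boundary ι ×ˢ (univ : Set I)) := isClosed_boundary.prod isClosed_univ
  have cl1 : IsClosed {w : (ι → I) × I | w.2 = 1} := isClosed_eq continuous_snd continuous_const
  have ca' : Continuous a' := continuousOn_univ.1 hp'.cont_a
  have cH' : Continuous H' := by simpa using hp'.cont_H
  have hp1 : LiftingProblem f univ (horn ι 1) α' β η' := by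
    refine ⟨?_, hp.cont_b, ?_, ?_, ?_⟩
    · rw [hhorn]
      exact ContinuousOn.union_of_isClosed (hp.cont_a.congr α0)
        ((ca'.comp continuous_fst).continuousOn.congr fun w hw => α1 w hw) cl0 cl1
    · rw [hhorn, union_prod]
      refine ContinuousOn.union_of_isClosed (hp.cont_H.congr η0) ?_ (cl0.prod isClosed_univ)
        (cl1.prod isClosed_univ)
      exact Continuous.continuousOn (f := fun w : ((ι → I) × I) × I => H' (w.1.1, w.2))
        (by fun_prop) |>.congr fun w hw => η1 w hw.1
    · rintro ⟨y, s⟩ (hy | (rfl : s = 1))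
      · rw [η0 ⟨⟨hy, trivial⟩, trivial⟩, α0 ⟨hy, trivial⟩, hp.H_zero _ ⟨hy, trivial⟩]
      · rw [η1 _ rfl, α1 _ rfl, hp'.H_zero _ trivial]
    · rintro ⟨y, s⟩ (hy | (rfl : s = 1))
      · rw [η0 ⟨⟨hy, trivial⟩, trivial⟩, hp.H_one _ ⟨hy, trivial⟩]
      · rw [η1 _ rfl, hp'.H_one _ trivial]
  obtain ⟨A, K, hs, hA, hK⟩ := help_horn f (Or.inr rfl) _ _ _ hp1
  have cA : Continuous A := continuousOn_univ.1 hs.cont_a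
  have cK : Continuous K := by simpa using hs.cont_H
  have cβ : Continuous β := continuousOn_univ.1 hp.cont_b
  refine ⟨fun z => A (z, 0), fun p => K ((p.1, 0), p.2), ⟨by fun_prop, by fun_prop, by fun_prop,
    fun z _ => hs.H_zero _ trivial, fun z _ => hs.H_one _ trivial⟩, fun z hz => ?_, fun p hp => ?_⟩
  · exact (hA (Or.inl hz)).trans (α0 ⟨hz, trivial⟩)
  · exact (hK ⟨Or.inl hp.1, trivial⟩).trans (η0 ⟨⟨hp.1, trivial⟩, trivial⟩)

end Lifting

/-! ### Weak equivalences and the homotopy extension and lifting property -/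

section Cubes

/-- The cube `I^{k+1}` as a product, the first coordinate being put last. -/
def cubeCons {k : ℕ} (w : (Fin k → I) × I) : Fin (k + 1) → I := Fin.cons w.2 w.1

/-- The inverse of `cubeCons`. -/
def cubeUncons {k : ℕ} (z : Fin (k + 1) → I) : (Fin k → I) × I := (Fin.tail z, z 0)

variable {k : ℕ}

@[simp] lemma cubeCons_cubeUncons (z : Fin (k + 1) → I) : cubeCons (cubeUncons z) = z :=
  Fin.cons_self_tail z

@[simp] lemma cubeUncons_cubeCons (w : (Fin k → I) × I) : cubeUncons (cubeCons w) = w := rfl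

@[fun_prop]
lemma continuous_cubeCons : Continuous (cubeCons : (Fin k → I) × I → _) := by
  refine continuous_pi fun i => ?_
  refine Fin.cases ?_ (fun i => ?_) i
  · exact continuous_snd
  · exact (continuous_apply i).comp continuous_fst

@[fun_prop]
lemma continuous_cubeUncons : Continuous (cubeUncons : _ → (Fin k → I) × I) :=
  (continuous_pi fun i => continuous_apply i.succ).prodMk (continuous_apply 0)

lemma cubeCons_mem_boundary {w : (Fin k → I) × I} :
    cubeCons w ∈ Cube.boundary (Fin (k + 1)) ↔ w ∈ horn (Fin k) 1 ∨ w.2 = 0 := by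
  simp only [Cube.boundary, mem_ofPred_eq, Fin.exists_fin_succ, horn]
  change (w.2 = 0 ∨ w.2 = 1) ∨ (∃ i, w.1 i = 0 ∨ w.1 i = 1) ↔ _
  rw [or_comm, or_comm (a := w.2 = 0), or_assoc]

end Cubes

section WeakEquiv

variable {X Y : Type u} [TopologicalSpace X] [TopologicalSpace Y] {f : C(X, Y)} {k : ℕ}

lemma Solvable.congr {Z : Type*} [TopologicalSpace Z] {f : X → Y} {B A : Set Z} {a a₁ : Z → X}
    {b : Z → Y} {H H₁ : Z × I → Y} (h : Solvable f B A a b H) (ha : EqOn a a₁ A)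
    (hH : EqOn H H₁ (A ×ˢ univ)) : Solvable f B A a₁ b H₁ := by
  obtain ⟨a', H', hp, ha', hH'⟩ := h
  exact ⟨a', H', hp, ha'.trans ha, hH'.trans hH⟩

/-- Surjectivity on homotopy groups solves the lifting problems that are constant on the
boundary. -/
lemma solvable_of_const {x : X} (hs : Function.Surjective (piMap f k x)) {b : (Fin k → I) → Y}
    (hb : Continuous b) (hx : ∀ z ∈ Cube.boundary (Fin k), b z = f x) :
    Solvable f univ (Cube.boundary (Fin k)) (fun _ => x) b (fun _ => f x) := by
  obtain ⟨q, hq⟩ := hs (Quotient.mk _ ⟨⟨b, hb⟩, hx⟩)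
  induction q using Quotient.inductionOn with | h q => ?_
  obtain ⟨F⟩ : (genLoopMap f k x q).1.HomotopicRel ⟨b, hb⟩ (Cube.boundary (Fin k)) :=
    Quotient.exact hq
  have cF : Continuous F := F.continuous
  refine ⟨q.1, fun p => F (p.2, p.1), ⟨q.1.continuous.continuousOn, hb.continuousOn, by fun_prop,
    fun z _ => F.apply_zero z, fun z _ => F.apply_one z⟩, fun z hz => q.2 z hz, fun p hp => ?_⟩
  exact (F.eq_snd p.2 hp.1).trans (hx _ hp.1)

/-- A lifting problem is solvable if `a` extends over the cube: contracting the cube reduces to the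
case of a constant `a`. -/
lemma solvable_of_extends (hs : ∀ x, Function.Surjective (piMap f k x)) {a : (Fin k → I) → X}
    (ha : Continuous a) {b : (Fin k → I) → Y} (hb : Continuous b)
    (hab : ∀ z ∈ Cube.boundary (Fin k), f (a z) = b z) :
    Solvable f univ (Cube.boundary (Fin k)) a b (fun p => f (a p.1)) := by
  let α : (Fin k → I) × I → X := fun p => a fun i => p.1 i * σ p.2
  have cα : Continuous α := ha.comp (by fun_prop)
  have α0 : ∀ z, α (z, 0) = a z := fun z => by simp [α]
  have α1 : ∀ z, α (z, 1) = a 0 := fun z => congrArg a (funext fun i => by simp)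
  obtain ⟨β, cβ, β0, hβ⟩ := exists_homotopy_extension hb (h := fun p => f (α p))
    (by fun_prop) fun z hz => by rw [α0, hab z hz]
  have := Solvable.of_homotopy (f := f) (α := α) (β := β) (η := fun p => f (α p.1))
    ⟨by fun_prop, by fun_prop, by fun_prop, fun _ _ => rfl, fun z hz => (hβ hz).symm⟩ (by
      simp only [α1]
      exact solvable_of_const (hs _) (by fun_prop) fun z hz =>
        (hβ (x := (z, 1)) ⟨hz, trivial⟩).trans (congrArg f (α1 z)))
  simpa only [α0, β0] using this

/-- If `a` is constant on all faces but one, it is a based map of a cube of lower dimension on that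
face, and injectivity on homotopy groups extends it over the cube. -/
lemma solvable_of_const_on_horn (hk : ∀ x, Function.Injective (piMap f k x))
    (hs : ∀ x, Function.Surjective (piMap f (k + 1) x)) {x : X} {a : (Fin (k + 1) → I) → X}
    (ha : ContinuousOn a (Cube.boundary (Fin (k + 1)))) {b : (Fin (k + 1) → I) → Y}
    (hb : Continuous b) (hab : ∀ z ∈ Cube.boundary (Fin (k + 1)), f (a z) = b z)
    (hx : ∀ w ∈ horn (Fin k) 1, a (cubeCons w) = x) :
    Solvable f univ (Cube.boundary (Fin (k + 1))) a b (fun p => f (a p.1)) := by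
  have hm : ∀ {w}, w ∈ horn (Fin k) 1 → cubeCons w ∈ Cube.boundary (Fin (k + 1)) :=
    fun h => cubeCons_mem_boundary.2 (Or.inl h)
  let p : GenLoop (Fin k) X x := ⟨⟨fun y => a (cubeCons (y, 0)), ha.comp_continuous (by fun_prop)
    fun y => cubeCons_mem_boundary.2 (Or.inr rfl)⟩, fun y hy => hx _ (Or.inl hy)⟩
  have hbx : ∀ w ∈ horn (Fin k) 1, b (cubeCons w) = f x := fun w hw => by
    rw [← hab _ (hm hw), hx w hw]
  obtain ⟨G⟩ : p.1.HomotopicRel (GenLoop.const (x := x) : GenLoop (Fin k) X x).1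
      (Cube.boundary (Fin k)) := by
    refine Quotient.exact (hk x (a₁ := Quotient.mk _ p) (a₂ := Quotient.mk _ GenLoop.const)
      (Quotient.sound ?_))
    refine ⟨⟨⟨⟨fun q => b (cubeCons (q.2, q.1)), by fun_prop⟩, fun y => ?_, fun y => ?_⟩, ?_⟩⟩
    · exact (hab _ (cubeCons_mem_boundary.2 (Or.inr rfl))).symm
    · exact hbx _ (Or.inr rfl)
    · intro t y hy
      exact (hbx _ (Or.inl hy)).trans (congrArg f (p.2 y hy)).symm
  have cG : Continuous G := G.continuous
  let a₀ : (Fin (k + 1) → I) → X := fun z => G ((cubeUncons z).2, (cubeUncons z).1)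
  have e : EqOn a₀ a (Cube.boundary (Fin (k + 1))) := by
    intro z hz
    obtain ⟨w, rfl⟩ : ∃ w, z = cubeCons w := ⟨_, (cubeCons_cubeUncons z).symm⟩
    obtain ⟨y, s⟩ := w
    change G (s, y) = _
    rcases cubeCons_mem_boundary.1 hz with (hw | (rfl : s = 1)) | (rfl : s = 0)
    · exact (G.eq_snd s hw).trans (hx _ (Or.inl hw)).symm
    · exact (G.apply_one y).trans (hx _ (Or.inr rfl)).symm
    · exact G.apply_zero y
  exact (solvable_of_extends hs (by fun_prop) hb fun z hz => by rw [e hz, hab z hz]).congr e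
    fun p hp => congrArg f (e hp.1)

/-- Lifting problems with a constant homotopy `H`: as a horn is contractible, such a problem is
homotopic to one that is constant on it. -/
lemma solvable_of_eq (hk : ∀ x, Function.Injective (piMap f k x))
    (hs : ∀ x, Function.Surjective (piMap f (k + 1) x)) {a : (Fin (k + 1) → I) → X}
    (ha : ContinuousOn a (Cube.boundary (Fin (k + 1)))) {b : (Fin (k + 1) → I) → Y}
    (hb : Continuous b) (hab : ∀ z ∈ Cube.boundary (Fin (k + 1)), f (a z) = b z) :
    Solvable f univ (Cube.boundary (Fin (k + 1))) a b (fun p => f (a p.1)) := by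
  classical
  have hm : ∀ {w}, w ∈ horn (Fin k) 1 → cubeCons w ∈ Cube.boundary (Fin (k + 1)) :=
    fun h => cubeCons_mem_boundary.2 (Or.inl h)
  obtain ⟨r, cr, hr, hr'⟩ := exists_horn_retraction (ι := Fin k) (j := 1) (Or.inr rfl)
  -- Contract the cube to its corner at the origin, and retract the contraction to the horn.
  let γ : ((Fin k → I) × I) × I → X := fun p =>
    a (cubeCons (r (fun i => p.1.1 i * σ p.2, p.1.2 * σ p.2)))
  have cγ : Continuous γ := ha.comp_continuous (by fun_prop) fun p => hm (hr _)
  have γ0 : ∀ w ∈ horn (Fin k) 1, γ (w, 0) = a (cubeCons w) := fun w hw => by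
    simp [γ, hr' w hw]
  have γ1 : ∀ w, γ (w, 1) = γ (0, 1) := fun w => by simp [γ]
  obtain ⟨δ, cδ, δ0, hδ⟩ := exists_homotopy_extension (ι := Fin k)
    (g := fun y => a (cubeCons (y, 0))) (ha.comp_continuous (by fun_prop)
      fun y => cubeCons_mem_boundary.2 (Or.inr rfl))
    (h := fun p => γ ((p.1, 0), p.2)) (by fun_prop) fun y hy => γ0 _ (Or.inl hy)
  let α : (Fin (k + 1) → I) × I → X := fun p =>
    if p.1 0 = 0 then δ (Fin.tail p.1, p.2) else γ (cubeUncons p.1, p.2)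
  have α_bot : ∀ y t, α (cubeCons (y, 0), t) = δ (y, t) := fun y t => if_pos rfl
  have α_horn : ∀ w ∈ horn (Fin k) 1, ∀ t, α (cubeCons w, t) = γ (w, t) := by
    rintro ⟨y, s⟩ hw t
    by_cases h0 : s = 0
    · subst h0
      rcases hw with hw | hw
      · rw [α_bot]
        exact hδ (x := (y, t)) ⟨hw, trivial⟩
      · exact absurd hw (by simp)
    · exact if_neg h0
  let A₁ : Set ((Fin (k + 1) → I) × I) := {p | cubeUncons p.1 ∈ horn (Fin k) 1}
  let A₂ : Set ((Fin (k + 1) → I) × I) := {p | p.1 0 = 0}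
  have hA : Cube.boundary (Fin (k + 1)) ×ˢ univ = A₁ ∪ A₂ := by
    ext ⟨z, t⟩
    obtain ⟨w, rfl⟩ : ∃ w, z = cubeCons w := ⟨_, (cubeCons_cubeUncons z).symm⟩
    rw [mem_prod, and_iff_left (mem_univ _), cubeCons_mem_boundary]
    rfl
  have cα : ContinuousOn α (Cube.boundary (Fin (k + 1)) ×ˢ univ) := by
    rw [hA]
    refine ContinuousOn.union_of_isClosed ?_ ?_
      ((isClosed_horn 1).preimage (by fun_prop))
      (isClosed_eq ((continuous_apply 0).comp continuous_fst) continuous_const)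
    · exact Continuous.continuousOn (f := fun p : (Fin (k + 1) → I) × I => γ (cubeUncons p.1, p.2))
        (by fun_prop) |>.congr fun p hp => by
          simpa using α_horn _ hp p.2
    · exact Continuous.continuousOn
        (f := fun p : (Fin (k + 1) → I) × I => δ ((cubeUncons p.1).1, p.2))
        (by fun_prop) |>.congr fun p hp => if_pos hp
  have α0 : ∀ z ∈ Cube.boundary (Fin (k + 1)), α (z, 0) = a z := by
    intro z hz
    obtain ⟨⟨y, s⟩, rfl⟩ : ∃ w, z = cubeCons w := ⟨_, (cubeCons_cubeUncons z).symm⟩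
    rcases cubeCons_mem_boundary.1 hz with hw | (rfl : s = 0)
    · rw [α_horn _ hw, γ0 _ hw]
    · rw [α_bot, δ0]
  have cfα : ContinuousOn (fun p => f (α p)) (Cube.boundary (Fin (k + 1)) ×ˢ univ) :=
    f.continuous.comp_continuousOn cα
  obtain ⟨β, cβ, β0, hβ⟩ := exists_homotopy_extension hb (h := fun p => f (α p)) cfα
    fun z hz => by rw [α0 z hz, hab z hz]
  have := Solvable.of_homotopy (f := f) (α := α) (β := β) (η := fun p => f (α p.1))
    ⟨cα, by fun_prop, cfα.comp continuousOn_fst fun p hp => hp.1, fun _ _ => rfl,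
      fun z hz => (hβ hz).symm⟩
    (solvable_of_const_on_horn hk hs (x := γ (0, 1))
      (cα.comp (by fun_prop) fun z hz => ⟨hz, trivial⟩) (by fun_prop)
      (fun z hz => (hβ (x := (z, 1)) ⟨hz, trivial⟩).symm)
      fun w hw => (α_horn w hw 1).trans (γ1 w))
  simp only [β0] at this
  exact this.congr α0 fun p hp => congrArg f (α0 _ hp.1)

/-- A weak homotopy equivalence has the homotopy extension and lifting property for cubes and their
boundaries. -/
lemma help_of_bijective_piMap (h : ∀ k x, Function.Bijective (piMap f k x)) [Nonempty X] (k : ℕ) :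
    HELP f univ (Cube.boundary (Fin k)) := by
  intro a b H hp
  have cb : Continuous b := continuousOn_univ.1 hp.cont_b
  cases k with
  | zero =>
    have h0 : Cube.boundary (Fin 0) = ∅ := by
      ext z; simp [Cube.boundary]
    have x : X := Classical.arbitrary X
    refine (solvable_of_const (h 0 x).2 cb ?_).congr ?_ ?_ <;> simp [h0]
  | succ k =>
    -- Reverse the homotopy `H` and extend it to one that starts at `b`.
    obtain ⟨β, cβ, β0, hβ⟩ := exists_homotopy_extension cb (h := fun p => H (p.1, σ p.2))
      (hp.cont_H.comp (by fun_prop) fun p hp => ⟨hp.1, trivial⟩)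
      fun z hz => by simpa using hp.H_one z hz
    have hab : ∀ z ∈ Cube.boundary (Fin (k + 1)), f (a z) = β (z, 1) := fun z hz => by
      rw [hβ (x := (z, 1)) ⟨hz, trivial⟩]
      simpa using (hp.H_zero z hz).symm
    have := Solvable.of_homotopy (f := f) (α := fun p => a p.1) (β := β)
      (η := fun p => H (p.1.1, p.2 * σ p.1.2))
      ⟨hp.cont_a.comp continuousOn_fst fun p hp => hp.1, by fun_prop,
        hp.cont_H.comp (by fun_prop) fun p hp => ⟨hp.1.1, trivial⟩,
        fun z hz => by simpa using hp.H_zero _ hz.1,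
        fun z hz => by simpa using (hβ hz).symm⟩
      ((solvable_of_eq (fun x => (h k x).1) (fun x => (h (k + 1) x).2) hp.cont_a (by fun_prop)
        hab).congr (fun _ _ => rfl) fun p hp' => by simpa using (hp.H_zero _ hp'.1).symm)
    simpa [β0] using this

/-- The converse: the homotopy extension and lifting property for cubes implies bijectivity on
homotopy groups. -/
lemma bijective_piMap_of_help (h : ∀ k, HELP f univ (Cube.boundary (Fin k))) (k : ℕ) (x : X) :
    Function.Bijective (piMap f k x) := by
  constructor
  · intro p q hpq
    induction p using Quotient.inductionOn with | h p => ?_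
    induction q using Quotient.inductionOn with | h q => ?_
    obtain ⟨F⟩ : (genLoopMap f k x p).1.HomotopicRel (genLoopMap f k x q).1
      (Cube.boundary (Fin k)) := Quotient.exact hpq
    have cF : Continuous F := F.continuous
    classical
    -- The problem on `I^{k+1}` that asks for a homotopy from `p` to `q` lifting `F`.
    let a : (Fin (k + 1) → I) → X := fun z => if z 0 = 0 then p (Fin.tail z) else q (Fin.tail z)
    let b : (Fin (k + 1) → I) → Y := fun z => F (z 0, Fin.tail z)
    have cb : Continuous b := cF.comp ((continuous_apply 0).prodMk
      (continuous_fst.comp continuous_cubeUncons))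
    have a0 : ∀ z : Fin (k + 1) → I, z 0 = 0 → a z = p (Fin.tail z) := fun z hz => if_pos hz
    have a1 : ∀ z : Fin (k + 1) → I, cubeUncons z ∈ horn (Fin k) 1 → a z = q (Fin.tail z) := by
      intro z hz
      by_cases h0 : z 0 = 0
      · rcases hz with hz | hz
        · rw [a0 z h0]
          exact (p.2 _ hz).trans (q.2 _ hz).symm
        · exact absurd (h0.symm.trans hz) (by simp)
      · exact if_neg h0
    have hB : Cube.boundary (Fin (k + 1)) = {z | cubeUncons z ∈ horn (Fin k) 1} ∪ {z | z 0 = 0} := by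
      ext z
      rw [← cubeCons_cubeUncons z, cubeCons_mem_boundary]
      rfl
    have hab : ∀ z ∈ Cube.boundary (Fin (k + 1)), f (a z) = b z := by
      intro z hz
      rw [hB] at hz
      rcases hz with hz | hz
      · rw [a1 z hz]
        rcases hz with hz | hz
        · exact (F.eq_snd (z 0) hz).symm
        · have h1 : z 0 = 1 := hz
          simp only [b, h1]
          exact (F.apply_one _).symm
      · rw [a0 z hz]
        have h0 : z 0 = 0 := hz
        simp only [b, h0]
        exact (F.apply_zero _).symm
    have ca : ContinuousOn a (Cube.boundary (Fin (k + 1))) := by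
      rw [hB]
      refine ContinuousOn.union_of_isClosed ?_ ?_
        ((isClosed_horn 1).preimage (by fun_prop))
        (isClosed_eq (continuous_apply 0) continuous_const)
      · exact (q.1.continuous.comp (continuous_fst.comp continuous_cubeUncons)).continuousOn.congr
          fun z hz => a1 z hz
      · exact (p.1.continuous.comp (continuous_fst.comp continuous_cubeUncons)).continuousOn.congr
          fun z hz => a0 z hz
    obtain ⟨a', H', hp', ha, -⟩ := h (k + 1) a b (fun z => b z.1) ⟨ca, cb.continuousOn,
      by fun_prop, fun z hz => (hab z hz).symm, fun z _ => rfl⟩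
    have ca' : Continuous a' := continuousOn_univ.1 hp'.cont_a
    refine Quotient.sound ⟨⟨⟨⟨fun w => a' (cubeCons (w.2, w.1)), by fun_prop⟩, fun y => ?_,
      fun y => ?_⟩, fun t y hy => ?_⟩⟩
    · exact (ha (cubeCons_mem_boundary.2 (Or.inr rfl))).trans (a0 _ rfl)
    · exact (ha (cubeCons_mem_boundary.2 (Or.inl (Or.inr rfl)))).trans (a1 _ (Or.inr rfl))
    · exact ((ha (cubeCons_mem_boundary.2 (Or.inl (Or.inl hy)))).trans
        (a1 (cubeCons (y, t)) (Or.inl hy))).trans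
        ((q.2 y hy).trans (p.2 y hy).symm)
  · intro q
    induction q using Quotient.inductionOn with | h q => ?_
    obtain ⟨a', H', hp', ha, hH⟩ := h k (fun _ => x) q (fun _ => f x)
      ⟨continuousOn_const, q.1.continuous.continuousOn, continuousOn_const, fun _ _ => rfl,
        fun z hz => (q.2 z hz).symm⟩
    have cH : Continuous H' := by simpa using hp'.cont_H
    refine ⟨Quotient.mk _ ⟨⟨a', continuousOn_univ.1 hp'.cont_a⟩, ha⟩, Quotient.sound
      ⟨⟨⟨⟨fun w => H' (w.2, w.1), by fun_prop⟩, fun y => hp'.H_zero y trivial,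
      fun y => hp'.H_one y trivial⟩, fun t y hy => ?_⟩⟩⟩
    exact (hH (x := (y, t)) ⟨hy, trivial⟩).trans (congrArg f (ha hy)).symm

end WeakEquiv

/-- Weak equivalences are the maps with the homotopy extension and lifting property for cubes and
their boundaries. -/
lemma isWeakEquiv_iff_help {X Y : PtCG.{u}} {f : X ⟶ Y} :
    IsWeakEquiv f ↔ ∀ k, HELP f univ (Cube.boundary (Fin k)) :=
  haveI : Nonempty X := ⟨X.pt⟩
  ⟨fun h => help_of_bijective_piMap h, fun h => bijective_piMap_of_help h⟩

/-! ### Polytopes and products of cubes with simplices -/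

section Polytope

variable {X Y : Type*} [TopologicalSpace X] [TopologicalSpace Y] {f : X → Y}

lemma HELP.cube (h : ∀ k, HELP f univ (Cube.boundary (Fin k))) (ι : Type*) [Fintype ι] :
    HELP f univ (Cube.boundary ι) := by
  let e := Fintype.equivFin ι
  refine (h (Fintype.card ι)).retract (subset_univ _) (i := fun y i => y (e.symm i))
    (r := fun y i => y (e i)) (by fun_prop) (by fun_prop) (mapsTo_univ _ _) ?_ (mapsTo_univ _ _) ?_
    (subset_univ _) fun z _ => by simp
  · rintro y ⟨i, hi⟩
    exact ⟨e i, by simpa using hi⟩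
  · rintro y ⟨i, hi⟩
    exact ⟨e.symm i, by simpa using hi⟩

/-- The interior of a polyhedron with a strictly interior point `p` is given by the strict
inequalities. -/
lemma interior_polyhedron {E κ : Type*} [NormedAddCommGroup E] [NormedSpace ℝ E] [Finite κ]
    (l : κ → E →L[ℝ] ℝ) (c : κ → ℝ) {p : E} (hp : ∀ j, l j p < c j) :
    interior {x | ∀ j, l j x ≤ c j} = {x | ∀ j, l j x < c j} := by
  refine subset_antisymm (fun x hx j => ?_) (interior_maximal (fun x hx j => (hx j).le) ?_)
  · -- Moving away from `p` stays inside for a short while, hence no constraint is sharp at `x`.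
    have ht : Filter.Tendsto (fun ε : ℝ => x + ε • (x - p)) (𝓝[>] 0) (𝓝 x) := by
      refine Filter.Tendsto.mono_left (Continuous.tendsto' (by fun_prop) _ _ (by simp))
        nhdsWithin_le_nhds
    obtain ⟨ε, hε, h0⟩ := ((ht.eventually (mem_interior_iff_mem_nhds.1 hx)).and
      self_mem_nhdsWithin).exists
    have h1 : l j x + ε * (l j x - l j p) ≤ c j := by simpa using hε j
    have h2 := hp j
    by_contra! h3
    have h4 : 0 < ε * (l j x - l j p) := mul_pos h0 (by linarith)
    linarith
  · have : {x | ∀ j, l j x < c j} = ⋂ j, {x | l j x < c j} := by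
      ext x; simp
    rw [this]
    exact isOpen_iInter_of_finite fun j => isOpen_lt (l j).continuous continuous_const

/-- The homotopy extension and lifting property passes from cubes to polytopes: all convex bodies of
the same dimension are homeomorphic. -/
lemma HELP.polytope (h : ∀ k, HELP f univ (Cube.boundary (Fin k))) {ι κ : Type*} [Fintype ι]
    [Finite κ] (l : κ → (ι → ℝ) →L[ℝ] ℝ) (c : κ → ℝ) {p : ι → ℝ} (hp : ∀ j, l j p < c j)
    (hb : Bornology.IsBounded {x | ∀ j, l j x ≤ c j}) :
    HELP f {x | ∀ j, l j x ≤ c j} {x | (∀ j, l j x ≤ c j) ∧ ∃ j, l j x = c j} := by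
  set s := {x | ∀ j, l j x ≤ c j} with hs
  have hint := interior_polyhedron l c hp
  have hI : s = ⋂ j, {x | l j x ≤ c j} := by
    ext x; simp [hs]
  have scl : IsClosed s := by
    rw [hI]
    exact isClosed_iInter fun j => isClosed_le (l j).continuous continuous_const
  have sconv : Convex ℝ s := by
    rw [hI]
    exact convex_iInter fun j => convex_halfSpace_le (l j).isLinear _
  have sfr : frontier s = {x | (∀ j, l j x ≤ c j) ∧ ∃ j, l j x = c j} := by
    rw [scl.frontier_eq, hint]
    ext x
    refine and_congr_right fun hx => ?_
    change (¬ ∀ j, l j x < c j) ↔ _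
    push Not
    exact exists_congr fun j => ⟨fun h => le_antisymm (hx j) h, fun h => h.ge⟩
  let t : Set (ι → ℝ) := Icc 0 1
  have tint : interior t = {x | ∀ i, x i ∈ Ioo (0 : ℝ) 1} := by
    change interior (Icc _ _) = _
    rw [← pi_univ_Icc, interior_pi_set finite_univ]
    ext x
    simp
  have tfr : ∀ x, x ∈ frontier t ↔ x ∈ t ∧ ∃ i, x i = 0 ∨ x i = 1 := by
    intro x
    rw [isClosed_Icc.frontier_eq, tint]
    refine and_congr_right fun hx => ?_
    change (¬ ∀ j, 0 < x j ∧ x j < 1) ↔ _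
    push Not
    refine exists_congr fun j => ⟨fun h => ?_, ?_⟩
    · rcases (hx.1 j).eq_or_lt with h0 | h0
      · exact Or.inl h0.symm
      · exact Or.inr (le_antisymm (hx.2 j) (h h0))
    · rintro (h | h) h'
      · exact absurd h h'.ne'
      · exact h.ge
  obtain ⟨e, -, e1, e2⟩ := exists_homeomorph_image_eq sconv ⟨p, hint.symm ▸ hp⟩
    (NormedSpace.isVonNBounded_of_isBounded ℝ hb) (convex_Icc (0 : ι → ℝ) 1)
    ⟨fun _ => 1 / 2, tint.symm ▸ fun i => by norm_num⟩
    (NormedSpace.isVonNBounded_of_isBounded ℝ (Metric.isBounded_Icc _ _))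
  rw [scl.closure_eq, isClosed_Icc.closure_eq] at e1
  rw [← sfr]
  have hes : ∀ x ∈ s, e x ∈ t := fun x hx =>
    (show e '' s = t from e1) ▸ mem_image_of_mem e hx
  have het : ∀ y ∈ t, e.symm y ∈ s := by
    intro y hy
    rw [← show e '' s = t from e1] at hy
    obtain ⟨x, hx, rfl⟩ := hy
    simpa using hx
  have hval : ∀ x ∈ t, ∀ i, (projIcc (0 : ℝ) 1 zero_le_one (x i) : ℝ) = x i := fun x hx i =>
    congrArg Subtype.val (projIcc_of_mem zero_le_one ⟨hx.1 i, hx.2 i⟩)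
  have cpr : Continuous (projIcc (0 : ℝ) 1 zero_le_one) := continuous_projIcc
  have ce := e.continuous
  have ce' := e.symm.continuous
  refine (HELP.cube h ι).retract scl.frontier_subset
    (i := fun x i => projIcc (0 : ℝ) 1 zero_le_one (e x i)) (r := fun y => e.symm fun i => y i)
    (by fun_prop) (by fun_prop) (mapsTo_univ _ _) ?_ ?_ ?_ (subset_univ _) ?_
  · intro x hx
    obtain ⟨-, i, hi⟩ := (tfr _).1 (e2 ▸ mem_image_of_mem e hx)
    refine ⟨i, ?_⟩
    dsimp only
    rcases hi with hi | hi
    · left; rw [hi]; simp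
    · right; rw [hi]; simp
  · exact fun y _ => het _ ⟨fun i => (y i).2.1, fun i => (y i).2.2⟩
  · rintro y ⟨i, hi⟩
    have : (fun i => (y i : ℝ)) ∈ frontier t := by
      refine (tfr _).2 ⟨⟨fun i => (y i).2.1, fun i => (y i).2.2⟩, i, ?_⟩
      rcases hi with hi | hi
      · left; simp [hi]
      · right; simp [hi]
    rw [← show e '' frontier s = frontier t from e2] at this
    obtain ⟨x, hx, hxy⟩ := this
    change e.symm (fun i => (y i : ℝ)) ∈ frontier s
    rw [← hxy]
    simpa using hx
  · intro x hx
    have : (fun i => (projIcc (0 : ℝ) 1 zero_le_one (e x i) : ℝ)) = e x :=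
      funext fun i => hval _ (hes x hx) i
    rw [this]
    simp

/-- The boundary of the simplex `Δ^U`. -/
def simplexFaceBoundary {n : ℕ} (U : Punctured n) : Set (stdSimplex ℝ (Fin (n + 1))) :=
  {t ∈ simplexFace U | ∃ i ∈ U.1, t i = 0}

/-- The homotopy extension and lifting property for the product of the pairs `(I^k, ∂I^k)` and
`(Δ^U, ∂Δ^U)`. -/
lemma HELP.cube_prod_simplexFace (h : ∀ k, HELP f univ (Cube.boundary (Fin k))) (k : ℕ) {n : ℕ}
    (U : Punctured n) :
    HELP f ((univ : Set (Fin k → I)) ×ˢ simplexFace U)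
      (Cube.boundary (Fin k) ×ˢ simplexFace U ∪ univ ×ˢ simplexFaceBoundary U) := by
  classical
  obtain ⟨i₀, hi₀⟩ := U.2
  -- The barycentric coordinates other than that of `i₀` identify `Δ^U` with a corner simplex.
  let J := {i // i ∈ U.1.erase i₀}
  let E := Fin k ⊕ J → ℝ
  let pj : Fin k ⊕ J → E →L[ℝ] ℝ := fun i => ContinuousLinearMap.proj i
  have hpj : ∀ i x, pj i x = x i := fun _ _ => rfl
  let l : (Fin k ⊕ Fin k) ⊕ (J ⊕ Unit) → E →L[ℝ] ℝ :=
    Sum.elim (Sum.elim (fun j => -pj (.inl j)) fun j => pj (.inl j))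
      (Sum.elim (fun i => -pj (.inr i)) fun _ => ∑ i, pj (.inr i))
  let c : (Fin k ⊕ Fin k) ⊕ (J ⊕ Unit) → ℝ :=
    Sum.elim (Sum.elim 0 1) (Sum.elim 0 1)
  have hle : ∀ x : E, (∀ j, l j x ≤ c j) ↔ (∀ j, 0 ≤ x (.inl j) ∧ x (.inl j) ≤ 1) ∧
      (∀ i, 0 ≤ x (.inr i)) ∧ ∑ i, x (.inr i) ≤ 1 := by
    intro x
    simp [l, c, hpj, Sum.forall, forall_and]
  have heq : ∀ x : E, (∃ j, l j x = c j) ↔ (∃ j, x (.inl j) = 0 ∨ x (.inl j) = 1) ∨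
      (∃ i, x (.inr i) = 0) ∨ ∑ i, x (.inr i) = 1 := by
    intro x
    simp [l, c, hpj, Sum.exists, exists_or]
  have hint : ∀ j, l j (Sum.elim (fun _ => 1 / 2) fun _ => 1 / (Fintype.card J + 1)) < c j := by
    have h0 : (0 : ℝ) < Fintype.card J + 1 := by positivity
    rintro ((j | j) | (i | j))
    · simp [l, c, hpj]
    · simp only [l, c, hpj, Sum.elim_inl, Sum.elim_inr, Pi.one_apply]
      norm_num
    · simp [l, c, hpj, h0]
    · simp only [l, c, hpj, Sum.elim_inr, FunLike.coe_sum, Finset.sum_apply, Finset.sum_const,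
        Finset.card_univ, nsmul_eq_mul, Pi.one_apply]
      rw [mul_one_div, div_lt_one h0]
      linarith
  have hbd : Bornology.IsBounded {x : E | ∀ j, l j x ≤ c j} := by
    refine (Metric.isBounded_Icc (0 : E) 1).subset fun x hx => ?_
    obtain ⟨h1, h2, h3⟩ := (hle x).1 hx
    refine ⟨?_, ?_⟩ <;> rintro (j | i)
    · exact (h1 j).1
    · exact h2 i
    · exact (h1 j).2
    · exact (Finset.single_le_sum (f := fun i => x (.inr i)) (fun i _ => h2 i)
        (Finset.mem_univ i)).trans h3
  -- The sum of the coordinates of a point of `Δ^U`.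
  have hsum : ∀ t ∈ simplexFace U, ∑ i : J, t i = 1 - t i₀ := by
    intro t ht
    have h1 : ∑ i, t i = 1 := t.2.2
    rw [Finset.sum_coe_sort (U.1.erase i₀) (fun i => t i)]
    rw [← Finset.sum_subset (Finset.subset_univ U.1) fun i _ hi => ht i hi,
      ← Finset.add_sum_erase _ _ hi₀] at h1
    linarith
  let v : E → Fin (n + 1) → ℝ := fun x i => if h : i ∈ U.1.erase i₀ then x (.inr ⟨i, h⟩) else
    if i = i₀ then 1 - ∑ i, x (.inr i) else 0
  have v_mem : ∀ (x : E) (i : J), v x i = x (.inr i) := fun x i => dif_pos i.2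
  have v_zero : ∀ x, v x i₀ = 1 - ∑ i, x (.inr i) := fun x => by simp [v]
  have v_out : ∀ x, ∀ i ∉ U.1, v x i = 0 := fun x i hi => by
    have h1 : i ≠ i₀ := fun h => hi (h ▸ hi₀)
    simp [v, hi, h1]
  have v_std : ∀ x : E, (∀ j, l j x ≤ c j) → v x ∈ stdSimplex ℝ (Fin (n + 1)) := by
    intro x hx
    obtain ⟨-, h2, h3⟩ := (hle x).1 hx
    refine ⟨fun i => ?_, ?_⟩
    · simp only [v]
      split_ifs
      · exact h2 _
      · linarith
      · exact le_rfl
    · rw [← Finset.sum_subset (Finset.subset_univ U.1) fun i _ hi => v_out x i hi,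
        ← Finset.add_sum_erase _ _ hi₀, ← Finset.sum_coe_sort (U.1.erase i₀), v_zero]
      simp only [v_mem]
      ring
  have cv : Continuous v := by
    refine continuous_pi fun i => ?_
    simp only [v]
    split_ifs <;> fun_prop
  let r : E → (Fin k → I) × stdSimplex ℝ (Fin (n + 1)) := fun x =>
    (fun j => projIcc 0 1 zero_le_one (x (.inl j)),
      if hx : ∀ j, l j x ≤ c j then ⟨v x, v_std x hx⟩ else
      ⟨Pi.single i₀ 1, single_mem_stdSimplex ℝ i₀⟩)
  have hr : ∀ x : E, (∀ j, l j x ≤ c j) → ∀ i, (r x).2 i = v x i := by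
    intro x hx i
    simp only [r, dif_pos hx]
    rfl
  have cr : ContinuousOn r {x : E | ∀ j, l j x ≤ c j} := by
    refine ContinuousOn.prodMk (Continuous.continuousOn ?_) ?_
    · exact continuous_pi fun j => continuous_projIcc.comp (continuous_apply _)
    · rw [continuousOn_iff_continuous_domRestrict]
      have : Continuous fun x : {x : E | ∀ j, l j x ≤ c j} =>
          (⟨v x, v_std x x.2⟩ : stdSimplex ℝ (Fin (n + 1))) := by fun_prop
      refine this.congr fun x => ?_
      have hx : ∀ j, l j x ≤ c j := x.2
      rw [domRestrict_apply, dif_pos hx]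
  let i : (Fin k → I) × stdSimplex ℝ (Fin (n + 1)) → E := fun p =>
    Sum.elim (fun j => p.1 j) fun i => p.2 i
  have ci : Continuous i := by
    refine continuous_pi ?_
    rintro (j | j)
    · exact continuous_subtype_val.comp ((continuous_apply j).comp continuous_fst)
    · exact (continuous_apply j.1).comp (continuous_subtype_val.comp continuous_snd)
  have hi : ∀ p ∈ (univ : Set (Fin k → I)) ×ˢ simplexFace U, ∀ j, l j (i p) ≤ c j := by
    rintro ⟨y, t⟩ ⟨-, ht⟩
    refine (hle _).2 ⟨fun j => (y j).2, fun i => t.2.1 i, ?_⟩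
    change ∑ i : J, t i ≤ 1
    rw [hsum t ht]
    linarith [show 0 ≤ t i₀ from t.2.1 i₀]
  have rB : MapsTo r {x : E | ∀ j, l j x ≤ c j} ((univ : Set (Fin k → I)) ×ˢ simplexFace U) :=
    fun x hx => ⟨trivial, fun i hi => by rw [hr x hx, v_out x i hi]⟩
  refine (HELP.polytope h l c hint hbd).retract ?_ ci.continuousOn cr hi ?_ rB ?_
    (fun x hx => hx.1) ?_
  · rintro p (hp | hp)
    · exact ⟨trivial, hp.2⟩
    · exact ⟨trivial, hp.2.1⟩
  · rintro ⟨y, t⟩ (⟨⟨j, hj⟩, ht⟩ | ⟨-, ht, i₁, hi₁, h0⟩)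
    · refine ⟨hi _ ⟨trivial, ht⟩, (heq _).2 (Or.inl ⟨j, ?_⟩)⟩
      rcases hj with hj | hj
      · exact Or.inl (congrArg Subtype.val hj)
      · exact Or.inr (congrArg Subtype.val hj)
    · refine ⟨hi _ ⟨trivial, ht⟩, (heq _).2 (Or.inr ?_)⟩
      by_cases hne : i₁ = i₀
      · right
        change ∑ i : J, t i = 1
        rw [hsum t ht, ← hne, h0, sub_zero]
      · exact Or.inl ⟨⟨i₁, Finset.mem_erase.2 ⟨hne, hi₁⟩⟩, h0⟩
  · rintro x ⟨hx, he⟩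
    rcases (heq x).1 he with ⟨j, hj⟩ | he
    · refine Or.inl ⟨⟨j, ?_⟩, (rB hx).2⟩
      rcases hj with hj | hj
      · left; simp only [r, hj]; simp
      · right; simp only [r, hj]; simp
    · refine Or.inr ⟨trivial, (rB hx).2, ?_⟩
      rcases he with ⟨i₁, h1⟩ | h1
      · exact ⟨i₁, Finset.mem_of_mem_erase i₁.2, by rw [hr x hx, v_mem, h1]⟩
      · exact ⟨i₀, hi₀, by rw [hr x hx, v_zero, h1, sub_self]⟩
  · rintro ⟨y, t⟩ hp
    refine Prod.ext (funext fun j => projIcc_val zero_le_one _) (Subtype.ext (funext fun j => ?_))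
    refine (hr _ (hi _ hp) j).trans ?_
    by_cases hj : j ∈ U.1.erase i₀
    · exact v_mem _ ⟨j, hj⟩
    · by_cases hj0 : j = i₀
      · subst hj0
        rw [v_zero]
        change 1 - ∑ i : J, t i = t j
        rw [hsum t hp.2]
        ring
      · have hjU : j ∉ U.1 := fun h => hj (Finset.mem_erase.2 ⟨hj0, h⟩)
        rw [v_out _ _ hjU]
        exact (hp.2 j hjU).symm

end Polytope

/-! ### Homotopy limits of punctured cubes preserve weak equivalences -/

section Holim

variable {n : ℕ} {D E : Punctured n ⥤ PtCG.{u}}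

lemma isClosed_simplexFace (U : Punctured n) : IsClosed (simplexFace U) := by
  have : simplexFace U = ⋂ i, ⋂ (_ : i ∉ U.1), {t : stdSimplex ℝ (Fin (n + 1)) | t i = 0} := by
    ext t; simp [simplexFace]
  rw [this]
  exact isClosed_iInter fun i => isClosed_iInter fun _ =>
    isClosed_eq ((continuous_apply i).comp continuous_subtype_val) continuous_const

instance (U : Punctured n) : CompactSpace (simplexFace U) :=
  isCompact_iff_compactSpace.1 (isClosed_simplexFace U).isCompact

lemma Holim.natural (φ : Holim.space D) {U V : Punctured n} (h : U ⟶ V)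
    {t : stdSimplex ℝ (Fin (n + 1))} (ht : t ∈ simplexFace U) :
    (ofK φ).1 V ⟨t, simplexFace_mono h ht⟩ = D.map h ((ofK φ).1 U ⟨t, ht⟩) :=
  (ofK φ).2 U V h ⟨t, ht⟩

open Classical in
/-- The evaluation of a point of the homotopy limit at a point of `Δ^U`, extended to the whole
simplex by the basepoint. -/
noncomputable def Holim.eval (U : Punctured n) (φ : Holim.space D)
    (t : stdSimplex ℝ (Fin (n + 1))) : D.obj U :=
  if ht : t ∈ simplexFace U then (ofK φ).1 U ⟨t, ht⟩ else (D.obj U).pt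

lemma Holim.eval_of_mem {U : Punctured n} (φ : Holim.space D) {t : stdSimplex ℝ (Fin (n + 1))}
    (ht : t ∈ simplexFace U) : Holim.eval U φ t = (ofK φ).1 U ⟨t, ht⟩ := dif_pos ht

lemma Holim.eval_natural (φ : Holim.space D) {U V : Punctured n} (h : U ⟶ V)
    {t : stdSimplex ℝ (Fin (n + 1))} (ht : t ∈ simplexFace U) :
    Holim.eval V φ t = D.map h (Holim.eval U φ t) := by
  rw [eval_of_mem φ ht, eval_of_mem φ (simplexFace_mono h ht), natural φ h ht]

lemma Holim.eval_map (α : D ⟶ E) (φ : Holim.space D) {U : Punctured n}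
    {t : stdSimplex ℝ (Fin (n + 1))} (ht : t ∈ simplexFace U) :
    Holim.eval U (Holim.functor.map α φ) t = α.app U (Holim.eval U φ t) := by
  rw [eval_of_mem φ ht]
  exact eval_of_mem (D := E) _ ht

lemma Holim.space_ext {φ ψ : Holim.space D}
    (h : ∀ U, ∀ t ∈ simplexFace U, Holim.eval U φ t = Holim.eval U ψ t) : φ = ψ := by
  refine Subtype.ext (funext fun U => ContinuousMap.ext fun t => ?_)
  have := h U t t.2
  rwa [eval_of_mem _ t.2, eval_of_mem _ t.2] at this

lemma Holim.continuousOn_eval {W : Type*} [TopologicalSpace W] {A : Set W} {φ : W → Holim.space D}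
    (hφ : ContinuousOn φ A) (U : Punctured n) :
    ContinuousOn (fun p : W × stdSimplex ℝ (Fin (n + 1)) => Holim.eval U (φ p.1) p.2)
      (A ×ˢ simplexFace U) := by
  rw [continuousOn_iff_continuous_domRestrict]
  have h1 : Continuous fun φ : Holim.space D => (ofK φ).1 U :=
    (continuous_apply U).comp (continuous_subtype_val.comp continuous_ofK)
  have h2 : Continuous fun p : (A ×ˢ simplexFace U : Set (W × stdSimplex ℝ (Fin (n + 1)))) =>
      (ofK (φ p.1.1)).1 U ⟨p.1.2, p.2.2⟩ := by
    have h3 : Continuous fun p : (A ×ˢ simplexFace U : Set (W × stdSimplex ℝ (Fin (n + 1)))) =>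
        φ p.1.1 :=
      hφ.comp_continuous (by fun_prop) fun p => p.2.1
    exact ContinuousEval.continuous_eval.comp ((h1.comp h3).prodMk (by fun_prop))
  exact h2.congr fun p => (eval_of_mem _ p.2.2).symm

/-- Maps from a compact Hausdorff space to the homotopy limit are natural families. -/
lemma Holim.exists_of_family {W : Type} [TopologicalSpace W] [CompactSpace W] [T2Space W]
    (ψ : ∀ U, W × stdSimplex ℝ (Fin (n + 1)) → D.obj U)
    (cψ : ∀ U, ContinuousOn (ψ U) (univ ×ˢ simplexFace U))
    (nat : ∀ {U V : Punctured n} (h : U ⟶ V) w, ∀ t ∈ simplexFace U,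
      ψ V (w, t) = D.map h (ψ U (w, t))) :
    ∃ φ : W → Holim.space D, Continuous φ ∧
      ∀ w U, ∀ t ∈ simplexFace U, Holim.eval U (φ w) t = ψ U (w, t) := by
  have cU : ∀ U, Continuous fun p : W × simplexFace U => ψ U (p.1, p.2) := fun U =>
    (cψ U).comp_continuous (by fun_prop) fun p => ⟨trivial, p.2.2⟩
  let φ : W → Holim.Pre D := fun w => ⟨fun U => ContinuousMap.curry ⟨_, cU U⟩ w,
    fun U V h t => nat h w t t.2⟩
  have cφ : Continuous φ := Continuous.subtype_mk
    (continuous_pi fun U => (ContinuousMap.curry ⟨_, cU U⟩).continuous) _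
  -- `Kify` is tested by compact Hausdorff spaces in the universe `u`, hence the lift of `W`.
  have c : Continuous fun w : ULift.{u} W => toK (φ w.down) :=
    continuous_toK_of_compact (cφ.comp continuous_uliftDown)
  exact ⟨fun w => toK (φ w), c.comp continuous_uliftUp, fun w U t ht => eval_of_mem _ ht⟩

/-- The support of a point of the simplex. -/
noncomputable def simplexSupport (t : stdSimplex ℝ (Fin (n + 1))) : Punctured n :=
  ⟨Finset.univ.filter fun i => t i ≠ 0, by
    by_contra h
    have h0 : ∀ i, t i = 0 := by simpa [Finset.filter_eq_empty_iff] using h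
    have h1 : ∑ i, t i = 1 := t.2.2
    simp [h0] at h1⟩

lemma mem_simplexFace_support (t : stdSimplex ℝ (Fin (n + 1))) :
    t ∈ simplexFace (simplexSupport t) := fun i hi => by
  simpa [simplexSupport] using hi

lemma simplexSupport_le {t : stdSimplex ℝ (Fin (n + 1))} {U : Punctured n}
    (ht : t ∈ simplexFace U) : simplexSupport t ≤ U := fun i hi => by
  by_contra h
  exact (Finset.mem_filter.1 hi).2 (ht i h)

lemma mem_simplexFaceBoundary {t : stdSimplex ℝ (Fin (n + 1))} {U : Punctured n} :
    t ∈ simplexFaceBoundary U ↔ ∃ V < U, t ∈ simplexFace V := by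
  constructor
  · rintro ⟨ht, i, hi, h0⟩
    refine ⟨_, lt_of_le_of_ne (simplexSupport_le ht) ?_, mem_simplexFace_support t⟩
    rintro rfl
    exact (Finset.mem_filter.1 hi).2 h0
  · rintro ⟨V, hV, ht⟩
    refine ⟨simplexFace_mono (homOfLE hV.le) ht, ?_⟩
    obtain ⟨i, hi, hi'⟩ := Finset.exists_of_ssubset (show V.1 ⊂ U.1 from hV)
    exact ⟨i, hi, ht i hi'⟩

/-- A family on `A × Δ^U` and a natural family on `W × Δ^V` for `V < U` glue to a map on
`A × Δ^U ∪ W × ∂Δ^U`. -/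
lemma exists_glue_boundary {W : Type*} [TopologicalSpace W] {A : Set W} (hA : IsClosed A)
    (U : Punctured n) {a a' : ∀ V, W × stdSimplex ℝ (Fin (n + 1)) → D.obj V}
    (ca : ContinuousOn (a U) (A ×ˢ simplexFace U))
    (nat : ∀ {V} (h : V ⟶ U), ∀ w ∈ A, ∀ t ∈ simplexFace V, a U (w, t) = D.map h (a V (w, t)))
    (ca' : ∀ V < U, ContinuousOn (a' V) (univ ×ˢ simplexFace V))
    (ext : ∀ V < U, ∀ w ∈ A, ∀ t ∈ simplexFace V, a' V (w, t) = a V (w, t))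
    (nat' : ∀ V < U, ∀ {V'} (h : V' ⟶ V), ∀ w, ∀ t ∈ simplexFace V',
      a' V (w, t) = D.map h (a' V' (w, t))) :
    ∃ g : W × stdSimplex ℝ (Fin (n + 1)) → D.obj U,
      ContinuousOn g (A ×ˢ simplexFace U ∪ univ ×ˢ simplexFaceBoundary U) ∧
      EqOn g (a U) (A ×ˢ simplexFace U) ∧
      ∀ V (h : V < U), ∀ w, ∀ t ∈ simplexFace V,
        g (w, t) = D.map (homOfLE h.le) (a' V (w, t)) := by
  classical
  let g : W × stdSimplex ℝ (Fin (n + 1)) → D.obj U := fun p =>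
    if p.1 ∈ A then a U p else
      if h : simplexSupport p.2 ≤ U then D.map (homOfLE h) (a' _ p) else (D.obj U).pt
  have g0 : EqOn g (a U) (A ×ˢ simplexFace U) := fun p hp => if_pos hp.1
  have g1 : ∀ V (h : V < U), ∀ w, ∀ t ∈ simplexFace V,
      g (w, t) = D.map (homOfLE h.le) (a' V (w, t)) := by
    intro V h w t ht
    by_cases hw : w ∈ A
    · rw [g0 ⟨hw, simplexFace_mono (homOfLE h.le) ht⟩, nat (homOfLE h.le) w hw t ht,
        ext V h w hw t ht]
    · have hs := simplexSupport_le ht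
      refine (if_neg hw).trans ((dif_pos (hs.trans h.le)).trans ?_)
      rw [nat' V h (homOfLE hs) w t (mem_simplexFace_support t)]
      exact PtCG.congr_apply (D.map_comp (homOfLE hs) (homOfLE h.le)) _
  refine ⟨g, ?_, g0, g1⟩
  have hu : (univ : Set W) ×ˢ simplexFaceBoundary U =
      ⋃ V : {V // V < U}, univ ×ˢ simplexFace V.1 := by
    ext ⟨w, t⟩
    simp [mem_simplexFaceBoundary]
  have hc : ∀ V : {V // V < U}, IsClosed ((univ : Set W) ×ˢ simplexFace V.1) := fun V =>
    isClosed_univ.prod (isClosed_simplexFace _)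
  rw [hu]
  refine ContinuousOn.union_of_isClosed (ca.congr g0) ?_ (hA.prod (isClosed_simplexFace U))
    (isClosed_iUnion_of_finite hc)
  refine (locallyFinite_of_finite _).continuousOn_iUnion hc fun V => ?_
  refine ((PtCG.hom_continuous (D.map (homOfLE V.2.le))).comp_continuousOn (ca' V.1 V.2)).congr ?_
  rintro ⟨w, t⟩ ht
  exact g1 V.1 V.2 w t ht.2

variable {Z : Type*} [TopologicalSpace Z]

/-- A family `(a', H')` solves, on `Δ^U`, the lifting problem given by natural families `(a, b, H)`,
and is compatible with the restriction to the faces of `Δ^U`. -/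
structure IsSolutionAt (α : D ⟶ E) (A : Set Z)
    (a : ∀ U, Z × stdSimplex ℝ (Fin (n + 1)) → D.obj U)
    (b : ∀ U, Z × stdSimplex ℝ (Fin (n + 1)) → E.obj U)
    (H : ∀ U, (Z × I) × stdSimplex ℝ (Fin (n + 1)) → E.obj U)
    (a' : ∀ U, Z × stdSimplex ℝ (Fin (n + 1)) → D.obj U)
    (H' : ∀ U, (Z × I) × stdSimplex ℝ (Fin (n + 1)) → E.obj U) (U : Punctured n) : Prop where
  cont_a : ContinuousOn (a' U) (univ ×ˢ simplexFace U)
  cont_H : ContinuousOn (H' U) (univ ×ˢ simplexFace U)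
  H_zero : ∀ z, ∀ t ∈ simplexFace U, H' U ((z, 0), t) = α.app U (a' U (z, t))
  H_one : ∀ z, ∀ t ∈ simplexFace U, H' U ((z, 1), t) = b U (z, t)
  ext_a : ∀ z ∈ A, ∀ t ∈ simplexFace U, a' U (z, t) = a U (z, t)
  ext_H : ∀ w ∈ A ×ˢ univ, ∀ t ∈ simplexFace U, H' U (w, t) = H U (w, t)
  nat_a : ∀ {V} (h : V ⟶ U), ∀ z, ∀ t ∈ simplexFace V, a' U (z, t) = D.map h (a' V (z, t))
  nat_H : ∀ {V} (h : V ⟶ U), ∀ w, ∀ t ∈ simplexFace V, H' U (w, t) = E.map h (H' V (w, t))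

/-- The lifting problem on a homotopy limit is solved simplex by simplex. -/
lemma exists_isSolutionAt {α : D ⟶ E} {A : Set Z} (hA : IsClosed A)
    {a : ∀ U, Z × stdSimplex ℝ (Fin (n + 1)) → D.obj U}
    {b : ∀ U, Z × stdSimplex ℝ (Fin (n + 1)) → E.obj U}
    {H : ∀ U, (Z × I) × stdSimplex ℝ (Fin (n + 1)) → E.obj U}
    (help : ∀ U, HELP (α.app U) ((univ : Set Z) ×ˢ simplexFace U)
      (A ×ˢ simplexFace U ∪ univ ×ˢ simplexFaceBoundary U))
    (ca : ∀ U, ContinuousOn (a U) (A ×ˢ simplexFace U))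
    (cb : ∀ U, ContinuousOn (b U) (univ ×ˢ simplexFace U))
    (cH : ∀ U, ContinuousOn (H U) ((A ×ˢ univ) ×ˢ simplexFace U))
    (H0 : ∀ U, ∀ z ∈ A, ∀ t ∈ simplexFace U, H U ((z, 0), t) = α.app U (a U (z, t)))
    (H1 : ∀ U, ∀ z ∈ A, ∀ t ∈ simplexFace U, H U ((z, 1), t) = b U (z, t))
    (na : ∀ {U V} (h : V ⟶ U), ∀ z ∈ A, ∀ t ∈ simplexFace V, a U (z, t) = D.map h (a V (z, t)))
    (nb : ∀ {U V} (h : V ⟶ U), ∀ z, ∀ t ∈ simplexFace V, b U (z, t) = E.map h (b V (z, t)))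
    (nH : ∀ {U V} (h : V ⟶ U), ∀ w ∈ A ×ˢ univ, ∀ t ∈ simplexFace V,
      H U (w, t) = E.map h (H V (w, t))) (m : ℕ) :
    ∃ a' H', ∀ U : Punctured n, U.1.card ≤ m → IsSolutionAt α A a b H a' H' U := by
  classical
  induction m with
  | zero => exact ⟨a, H, fun U hU => absurd U.2 (by simpa using hU)⟩
  | succ m ih =>
    obtain ⟨a', H', hs⟩ := ih
    -- Extend the solution over the simplices of dimension `m`, their boundaries being done.
    have key : ∀ U : Punctured n, ∃ (a₁ : Z × stdSimplex ℝ (Fin (n + 1)) → D.obj U)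
        (H₁ : (Z × I) × stdSimplex ℝ (Fin (n + 1)) → E.obj U),
        (U.1.card ≤ m → a₁ = a' U ∧ H₁ = H' U) ∧ (U.1.card = m + 1 →
          ContinuousOn a₁ (univ ×ˢ simplexFace U) ∧ ContinuousOn H₁ (univ ×ˢ simplexFace U) ∧
          (∀ z, ∀ t ∈ simplexFace U, H₁ ((z, 0), t) = α.app U (a₁ (z, t))) ∧
          (∀ z, ∀ t ∈ simplexFace U, H₁ ((z, 1), t) = b U (z, t)) ∧
          (∀ z ∈ A, ∀ t ∈ simplexFace U, a₁ (z, t) = a U (z, t)) ∧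
          (∀ w ∈ A ×ˢ univ, ∀ t ∈ simplexFace U, H₁ (w, t) = H U (w, t)) ∧
          (∀ V (h : V < U), ∀ z, ∀ t ∈ simplexFace V,
            a₁ (z, t) = D.map (homOfLE h.le) (a' V (z, t))) ∧
          (∀ V (h : V < U), ∀ w, ∀ t ∈ simplexFace V,
            H₁ (w, t) = E.map (homOfLE h.le) (H' V (w, t)))) := by
      intro U
      by_cases hU : U.1.card = m + 1
      swap
      · exact ⟨a' U, H' U, fun _ => ⟨rfl, rfl⟩, fun h => absurd h hU⟩
      have hlt : ∀ V < U, IsSolutionAt α A a b H a' H' V := fun V hV => by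
        have := Finset.card_lt_card (show V.1 ⊂ U.1 from hV)
        exact hs V (by omega)
      obtain ⟨g, cg, g0, g1⟩ := exists_glue_boundary hA U (ca U) na (fun V h => (hlt V h).cont_a)
        (fun V h => (hlt V h).ext_a) (fun V h => (hlt V h).nat_a)
      obtain ⟨K, cK, K0, K1⟩ := exists_glue_boundary (hA.prod isClosed_univ) U (cH U) nH
        (fun V h => (hlt V h).cont_H) (fun V h => (hlt V h).ext_H) (fun V h => (hlt V h).nat_H)
      obtain ⟨a₁, H₁, lp, ea, eH⟩ := help U g (b U) (fun p => K ((p.1.1, p.2), p.1.2))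
        ⟨cg, cb U, by
          refine cK.comp (by fun_prop) ?_
          rintro ⟨⟨z, t⟩, s⟩ ⟨hp | hp, -⟩
          · exact Or.inl ⟨⟨hp.1, trivial⟩, hp.2⟩
          · exact Or.inr ⟨trivial, hp.2⟩, by
          rintro ⟨z, t⟩ (hp | hp)
          · rw [g0 hp, ← H0 U z hp.1 t hp.2]
            exact K0 ⟨⟨hp.1, trivial⟩, hp.2⟩
          · obtain ⟨V, hV, ht⟩ := mem_simplexFaceBoundary.1 hp.2
            change K ((z, 0), t) = _
            rw [K1 V hV _ t ht, g1 V hV z t ht, (hlt V hV).H_zero z t ht]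
            exact (PtCG.congr_apply (α.naturality (homOfLE hV.le)) _).symm, by
          rintro ⟨z, t⟩ (hp | hp)
          · rw [← H1 U z hp.1 t hp.2]
            exact K0 ⟨⟨hp.1, trivial⟩, hp.2⟩
          · obtain ⟨V, hV, ht⟩ := mem_simplexFaceBoundary.1 hp.2
            change K ((z, 1), t) = _
            rw [K1 V hV _ t ht, (hlt V hV).H_one z t ht, nb (homOfLE hV.le) z t ht]⟩
      refine ⟨a₁, fun p => H₁ ((p.1.1, p.2), p.1.2), fun h => absurd hU (by omega), fun _ =>
        ⟨lp.cont_a, lp.cont_H.comp (by fun_prop) fun p hp => ⟨⟨trivial, hp.2⟩, trivial⟩,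
        fun z t ht => lp.H_zero (z, t) ⟨trivial, ht⟩, fun z t ht => lp.H_one (z, t) ⟨trivial, ht⟩,
        fun z hz t ht => ?_, fun w hw t ht => ?_, fun V h z t ht => ?_, fun V h w t ht => ?_⟩⟩
      · rw [ea (Or.inl ⟨hz, ht⟩), g0 ⟨hz, ht⟩]
      · exact (eH (x := ((w.1, t), w.2)) ⟨Or.inl ⟨hw.1, ht⟩, trivial⟩).trans (K0 ⟨hw, ht⟩)
      · rw [ea (Or.inr ⟨trivial, mem_simplexFaceBoundary.2 ⟨V, h, ht⟩⟩), g1 V h z t ht]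
      · exact (eH (x := ((w.1, t), w.2))
          ⟨Or.inr ⟨trivial, mem_simplexFaceBoundary.2 ⟨V, h, ht⟩⟩, trivial⟩).trans (K1 V h w t ht)
    choose a₁ H₁ hold hnew using key
    have hid : ∀ (F : Punctured n ⥤ PtCG.{u}) {U : Punctured n} (h : U ⟶ U) (x : F.obj U),
        F.map h x = x := fun F U h x => by
      rw [Subsingleton.elim h (𝟙 U)]
      exact PtCG.congr_apply (F.map_id U) x
    refine ⟨a₁, H₁, fun U hU => ?_⟩
    have hVm : ∀ {V : Punctured n}, V < U → V.1.card ≤ m := fun {V} hV => by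
      have := Finset.card_lt_card (show V.1 ⊂ U.1 from hV)
      omega
    rcases Nat.lt_or_ge m U.1.card with h | h
    · obtain ⟨c1, c2, h0, h1, e1, e2, n1, n2⟩ := hnew U (by omega)
      refine ⟨c1, c2, h0, h1, e1, e2, fun {V} h z t ht => ?_, fun {V} h w t ht => ?_⟩
      · rcases (leOfHom h).eq_or_lt with rfl | hV
        · exact (hid D h _).symm
        · rw [n1 V hV z t ht, (hold V (hVm hV)).1]
          rfl
      · rcases (leOfHom h).eq_or_lt with rfl | hV
        · exact (hid E h _).symm
        · rw [n2 V hV w t ht, (hold V (hVm hV)).2]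
          rfl
    · have hsU := hs U h
      have hle : ∀ {V : Punctured n}, (V ⟶ U) → V.1.card ≤ m := fun {V} h' =>
        (Finset.card_le_card (show V.1 ⊆ U.1 from leOfHom h')).trans h
      obtain ⟨e1, e2⟩ := hold U h
      refine ⟨?_, ?_, ?_, ?_, ?_, ?_, fun {V} h' => ?_, fun {V} h' => ?_⟩ <;>
        simp only [e1, e2]
      · exact hsU.cont_a
      · exact hsU.cont_H
      · exact hsU.H_zero
      · exact hsU.H_one
      · exact hsU.ext_a
      · exact hsU.ext_H
      · rw [(hold V (hle h')).1]
        exact hsU.nat_a h'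
      · rw [(hold V (hle h')).2]
        exact hsU.nat_H h'

/-- The homotopy limit of punctured cubes preserves objectwise weak equivalences. -/
lemma isWeakEquiv_holimMap (α : D ⟶ E) (h : ∀ U, IsWeakEquiv (α.app U)) :
    IsWeakEquiv (Holim.functor.map α) := by
  rw [isWeakEquiv_iff_help]
  intro k a b H hp
  have H_comp : ∀ {φ : Holim.space E} {ψ : Holim.space D}, φ = Holim.functor.map α ψ →
      ∀ U, ∀ t ∈ simplexFace U, Holim.eval U φ t = α.app U (Holim.eval U ψ t) := by
    rintro _ ψ rfl U t ht
    exact Holim.eval_map α ψ ht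
  obtain ⟨a', H', hs⟩ := exists_isSolutionAt (α := α) (isClosed_boundary (ι := Fin k))
    (a := fun U p => Holim.eval U (a p.1) p.2) (b := fun U p => Holim.eval U (b p.1) p.2)
    (H := fun U p => Holim.eval U (H p.1) p.2)
    (fun U => HELP.cube_prod_simplexFace (isWeakEquiv_iff_help.1 (h U)) k U)
    (Holim.continuousOn_eval hp.cont_a) (Holim.continuousOn_eval hp.cont_b)
    (Holim.continuousOn_eval hp.cont_H)
    (fun U z hz t ht => H_comp (hp.H_zero z hz) U t ht)
    (fun U z hz t ht => by rw [hp.H_one z hz])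
    (fun h z _ t ht => Holim.eval_natural _ h ht) (fun h z t ht => Holim.eval_natural _ h ht)
    (fun h w _ t ht => Holim.eval_natural _ h ht) (n + 1)
  replace hs := fun U : Punctured n => hs U (by simpa using Finset.card_le_univ U.1)
  obtain ⟨φ, cφ, hφ⟩ := Holim.exists_of_family a' (fun U => (hs U).cont_a)
    fun {U V} h => (hs V).nat_a h
  obtain ⟨ψ, cψ, hψ⟩ := Holim.exists_of_family H' (fun U => (hs U).cont_H)
    fun {U V} h => (hs V).nat_H h
  refine ⟨φ, ψ, ⟨cφ.continuousOn, hp.cont_b, cψ.continuousOn, fun z _ => ?_, fun z _ => ?_⟩,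
    fun z hz => ?_, fun w hw => ?_⟩
  · refine Holim.space_ext fun U t ht => ?_
    rw [hψ _ U t ht, (hs U).H_zero z t ht, ← hφ z U t ht]
    exact (Holim.eval_map α (φ z) ht).symm
  · exact Holim.space_ext fun U t ht => (hψ _ U t ht).trans ((hs U).H_one z t ht)
  · exact Holim.space_ext fun U t ht => (hφ _ U t ht).trans ((hs U).ext_a z hz t ht)
  · exact Holim.space_ext fun U t ht => (hψ _ U t ht).trans ((hs U).ext_H w hw t ht)

end Holim

/-! ### Mapping telescopes preserve weak equivalences -/

namespace Telescope

variable {X Y : ℕ → PtCG.{u}} {f : ∀ k, X k ⟶ X (k + 1)} {g : ∀ k, Y k ⟶ Y (k + 1)}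

/-- The point of the telescope over `x : X k` at height `k + s`. -/
def point (k : ℕ) (x : X k) (s : I) : space X f := Quot.mk _ ⟨k, x, s⟩

lemma point_one (k : ℕ) (x : X k) :
    (point k x 1 : space X f) = point (k + 1) (f k x) 0 :=
  Quot.sound (.glue k x)

lemma continuous_point (k : ℕ) : Continuous fun p : X k × I => (point k p.1 p.2 : space X f) :=
  continuous_quot_mk.comp (@continuous_sigmaMk ℕ (fun k => X k × I) _ k)

lemma ind {P : space X f → Prop} (h : ∀ k x s, P (point k x s)) (z) : P z :=
  Quot.ind (fun p => h p.1 p.2.1 p.2.2) z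

/-- Maps out of the telescope. -/
def lift {W : Type*} (φ : ∀ k, X k → I → W) (h : ∀ k x, φ k x 1 = φ (k + 1) (f k x) 0) :
    space X f → W :=
  Quot.lift (fun p => φ p.1 p.2.1 p.2.2) (by
    rintro _ _ ⟨k, x⟩
    exact h k x)

lemma continuous_lift {W : Type*} [TopologicalSpace W] {φ : ∀ k, X k → I → W}
    {h : ∀ k x, φ k x 1 = φ (k + 1) (f k x) 0}
    (hφ : ∀ k, Continuous fun p : X k × I => φ k p.1 p.2) : Continuous (lift (f := f) φ h) :=
  continuous_quot_lift _ (continuous_sigma hφ)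

/-- The height function of the telescope. -/
def height : space X f → ℝ := lift (fun k _ s => k + s) fun k x => by simp

lemma continuous_height : Continuous (height : space X f → ℝ) :=
  continuous_lift fun k => by fun_prop

lemma height_point (k : ℕ) (x : X k) (s : I) : height (point k x s : space X f) = k + s := rfl

/-- The inclusion of the telescope of the shifted sequence. -/
def incl : space (fun k => X (k + 1)) (fun k => f (k + 1)) → space X f :=
  lift (fun k x s => point (k + 1) x s) fun k x => point_one (k + 1) x

lemma continuous_incl : Continuous (incl (X := X) (f := f)) :=
  continuous_lift fun k => continuous_point (k + 1)

/-- The retraction of the telescope to that of the shifted sequence, collapsing the first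
cylinder. -/
def shift : space X f → space (fun k => X (k + 1)) (fun k => f (k + 1)) :=
  lift (fun k => match k with
    | 0 => fun x _ => point (X := fun k => X (k + 1)) 0 (f 0 x) 0
    | k + 1 => fun x s => point (X := fun k => X (k + 1)) k x s) (by
    rintro (_ | k) x
    · rfl
    · exact point_one (X := fun k => X (k + 1)) k x)

lemma continuous_shift : Continuous (shift (X := X) (f := f)) := by
  refine continuous_lift ?_
  rintro (_ | k)
  · exact (continuous_point (X := fun k => X (k + 1)) 0).comp
      (((PtCG.hom_continuous (f 0)).comp continuous_fst).prodMk continuous_const)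
  · exact continuous_point (X := fun k => X (k + 1)) k

lemma height_shift_le {N : ℕ} {z : space X f} (hz : height z ≤ N + 1) : height (shift z) ≤ N := by
  induction z using ind with
  | h k x s =>
    rcases k with _ | k
    · exact (by simp : ((0 : ℕ) : ℝ) + ((0 : I) : ℝ) ≤ N)
    · change (k : ℝ) + s ≤ N
      have : ((k + 1 : ℕ) : ℝ) + s ≤ N + 1 := hz
      push_cast at this
      linarith

/-- The homotopy from the identity to `incl ∘ shift` that slides the first cylinder to its end. -/
def slide (t : I) : space X f → space X f :=
  lift (fun k => match k with
    | 0 => fun x s => point 0 x (max s t)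
    | k + 1 => fun x s => point (k + 1) x s) (by
    rintro (_ | k) x
    · change point 0 x (max 1 t) = _
      rw [max_eq_left unitInterval.le_one']
      exact point_one 0 x
    · exact point_one (k + 1) x)

lemma continuous_slide : Continuous fun p : space X f × I => slide p.2 p.1 := by
  let c : space X f → C(I, space X f) := lift (fun k => match k with
      | 0 => fun x s => ⟨fun t => point 0 x (max s t),
          (continuous_point 0).comp (by fun_prop : Continuous fun t : I => (x, max s t))⟩
      | k + 1 => fun x s => ContinuousMap.const _ (point (k + 1) x s)) (by
      rintro (_ | k) x
      · ext t
        change point 0 x (max 1 t) = _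
        rw [max_eq_left unitInterval.le_one']
        exact point_one 0 x
      · exact congrArg (ContinuousMap.const I) (point_one (k + 1) x))
  have cc : Continuous c := by
    refine continuous_lift ?_
    rintro (_ | k)
    · refine (ContinuousMap.curry (⟨fun p : (X 0 × I) × I => point 0 p.1.1 (max p.1.2 p.2),
        ?_⟩ : C((X 0 × I) × I, space X f))).continuous
      exact (continuous_point 0).comp (by fun_prop :
        Continuous fun p : (X 0 × I) × I => (p.1.1, max p.1.2 p.2))
    · exact ContinuousMap.continuous_const'.comp (continuous_point (k + 1))
  refine (ContinuousMap.continuous_uncurry_of_continuous ⟨c, cc⟩).congr ?_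
  rintro ⟨z, t⟩
  induction z using ind with
  | h k x s => rcases k with _ | k <;> rfl

lemma slide_zero (z : space X f) : slide 0 z = z := by
  induction z using ind with
  | h k x s =>
    rcases k with _ | k
    · exact congrArg (point 0 x) (max_eq_left s.2.1)
    · rfl

lemma slide_one (z : space X f) : slide 1 z = incl (shift z) := by
  induction z using ind with
  | h k x s =>
    rcases k with _ | k
    · exact (congrArg (point 0 x) (max_eq_right s.2.2)).trans (point_one 0 x)
    · rfl

/-- The projection of the part of height less than `1` to `X 0`; the rest of the telescope is sent
to the basepoint. -/
noncomputable def bottom : space X f → X 0 :=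
  lift (fun k => match k with
    | 0 => fun x s => if s = 1 then (X 0).pt else x
    | _ + 1 => fun _ _ => (X 0).pt) (by
    rintro (_ | k) x
    · exact if_pos rfl
    · rfl)

lemma continuousOn_bottom : ContinuousOn (bottom (X := X) (f := f)) {z | height z < 1} := by
  have ho : IsOpen {z : space X f | height z < 1} :=
    isOpen_lt continuous_height continuous_const
  rw [continuousOn_open_iff ho]
  intro V hV
  refine isOpen_coinduced.2 (isOpen_sigma_iff.2 ?_)
  rintro (_ | k)
  · have : (Sigma.mk 0) ⁻¹' (Quot.mk (Rel X f) ⁻¹' ({z : space X f | height z < 1} ∩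
        bottom ⁻¹' V)) = {p : X 0 × I | (p.2 : ℝ) < 1} ∩ Prod.fst ⁻¹' V := by
      ext ⟨x, s⟩
      have h1 : height (point 0 x s : space X f) = s := by simp [height_point]
      change (height (point 0 x s : space X f) < 1 ∧
        (if s = 1 then (X 0).pt else x) ∈ V) ↔ ((s : ℝ) < 1 ∧ x ∈ V)
      rw [h1]
      refine and_congr_right fun hs => ?_
      rw [if_neg]
      rintro rfl
      simp at hs
    exact (congrArg IsOpen this).mpr
      ((isOpen_lt (by fun_prop) continuous_const).inter (hV.preimage continuous_fst))
  · convert isOpen_empty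
    refine Set.eq_empty_of_forall_notMem ?_
    rintro ⟨x, s⟩ ⟨hs, -⟩
    have h1 : ((k + 1 : ℕ) : ℝ) + s < 1 := hs
    push_cast at h1
    linarith [s.2.1, (k.cast_nonneg : (0 : ℝ) ≤ k)]

lemma point_bottom {z : space X f} (hz : height z ≤ 0) : point 0 (bottom z) 0 = z := by
  induction z using ind with
  | h k x s =>
    have h1 : (k : ℝ) + s ≤ 0 := hz
    have h2 := s.2.1
    have h3 : (0 : ℝ) ≤ k := k.cast_nonneg
    obtain rfl : k = 0 := by
      have : (k : ℝ) = 0 := by linarith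
      exact_mod_cast this
    obtain rfl : s = 0 := Subtype.ext (by simp only [Icc.coe_zero]; linarith)
    change point 0 (if (0 : I) = 1 then (X 0).pt else x) 0 = _
    rw [if_neg zero_ne_one]

variable {α : ∀ k, X k ⟶ Y k} {h : ∀ k, f k ≫ α (k + 1) = α k ≫ g k}

lemma slide_map (t : I) (z : space X f) : slide t (map α h z) = map α h (slide t z) := by
  induction z using ind with
  | h k x s => rcases k with _ | k <;> rfl

lemma shift_map (z : space X f) : shift (map α h z) =
    map (fun k => α (k + 1)) (fun k => h (k + 1)) (shift z) := by
  induction z using ind with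
  | h k x s =>
    rcases k with _ | k
    · exact mk_congr (X := fun k => Y (k + 1)) 0 (PtCG.congr_apply (h 0) x).symm 0
    · rfl

lemma incl_map (z : space (fun k => X (k + 1)) (fun k => f (k + 1))) :
    incl (map (fun k => α (k + 1)) (fun k => h (k + 1)) z) = map α h (incl z) := by
  induction z using ind with
  | h k x s => rfl

lemma bottom_map (z : space X f) : bottom (map α h z) = α 0 (bottom z) := by
  induction z using ind with
  | h k x s =>
    rcases k with _ | k
    · change (if s = 1 then (Y 0).pt else α 0 x) = α 0 (if s = 1 then (X 0).pt else x)
      split_ifs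
      · exact (PtCG.apply_pt _).symm
      · rfl
    · exact (PtCG.apply_pt _).symm

/-- Lifting problems of bounded height are solvable: sliding up reduces the height bound, and
problems of height `0` are problems for `α 0`. -/
lemma solvable_of_height_le (k N : ℕ) : ∀ {X Y : ℕ → PtCG.{u}} {f : ∀ k, X k ⟶ X (k + 1)}
    {g : ∀ k, Y k ⟶ Y (k + 1)} {α : ∀ k, X k ⟶ Y k} {h : ∀ k, f k ≫ α (k + 1) = α k ≫ g k}
    (_ : ∀ k, IsWeakEquiv (α k)) {a : (Fin k → I) → space X f} {b : (Fin k → I) → space Y g}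
    {H : (Fin k → I) × I → space Y g}
    (_ : LiftingProblem (map α h) univ (Cube.boundary (Fin k)) a b H)
    (_ : ∀ z ∈ Cube.boundary (Fin k), height (a z) ≤ N) (_ : ∀ z, height (b z) ≤ N)
    (_ : ∀ p ∈ Cube.boundary (Fin k) ×ˢ (univ : Set I), height (H p) ≤ N),
    Solvable (map α h) univ (Cube.boundary (Fin k)) a b H := by
  induction N with
  | zero =>
    intro X Y f g α h hα a b H hp ha hb hH
    have ha' : ∀ z ∈ Cube.boundary (Fin k), height (a z) ≤ 0 := by simpa using ha
    have hb' : ∀ z, height (b z) ≤ 0 := by simpa using hb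
    have hH' : ∀ p ∈ Cube.boundary (Fin k) ×ˢ (univ : Set I), height (H p) ≤ 0 := by
      simpa using hH
    obtain ⟨a', H', hp', ea, eH⟩ := isWeakEquiv_iff_help.1 (hα 0) k (fun z => bottom (a z))
      (fun z => bottom (b z)) (fun p => bottom (H p))
      ⟨continuousOn_bottom.comp hp.cont_a fun z hz => (ha' z hz).trans_lt one_pos,
        continuousOn_bottom.comp hp.cont_b fun z _ => (hb' z).trans_lt one_pos,
        continuousOn_bottom.comp hp.cont_H fun p hp => (hH' p hp).trans_lt one_pos,
        fun z hz => by rw [hp.H_zero z hz, bottom_map], fun z hz => by rw [hp.H_one z hz]⟩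
    have ca' : Continuous a' := continuousOn_univ.1 hp'.cont_a
    have cH' : Continuous H' := by simpa using hp'.cont_H
    refine ⟨fun z => point 0 (a' z) 0, fun p => point 0 (H' p) 0,
      ⟨((continuous_point 0).comp (ca'.prodMk continuous_const)).continuousOn, hp.cont_b,
        ((continuous_point 0).comp (cH'.prodMk continuous_const)).continuousOn,
        fun z _ => ?_, fun z _ => ?_⟩, fun z hz => ?_, fun p hp => ?_⟩
    · exact congrArg (point 0 · 0) (hp'.H_zero z trivial)
    · exact (congrArg (point 0 · 0) (hp'.H_one z trivial)).trans (point_bottom (hb' z))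
    · exact (congrArg (point 0 · 0) (ea hz)).trans (point_bottom (ha' z hz))
    · exact (congrArg (point 0 · 0) (eH hp)).trans (point_bottom (hH' p hp))
  | succ N ih =>
    intro X Y f g α h hα a b H hp ha hb hH
    simp only [Nat.cast_add, Nat.cast_one] at ha hb hH
    have cb : Continuous b := continuousOn_univ.1 hp.cont_b
    obtain ⟨a', H', hp', ea, eH⟩ := ih (α := fun k => α (k + 1)) (h := fun k => h (k + 1))
      (fun k => hα (k + 1)) (a := fun z => shift (a z)) (b := fun z => shift (b z))
      (H := fun p => shift (H p))
      ⟨continuous_shift.comp_continuousOn hp.cont_a, continuous_shift.comp_continuousOn hp.cont_b,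
        continuous_shift.comp_continuousOn hp.cont_H,
        fun z hz => by rw [hp.H_zero z hz, shift_map], fun z hz => by rw [hp.H_one z hz]⟩
      (fun z hz => height_shift_le (ha z hz)) (fun z => height_shift_le (hb z))
      fun p hp => height_shift_le (hH p hp)
    have := Solvable.of_homotopy (f := map α h) (α := fun p => slide p.2 (a p.1))
      (β := fun p => slide p.2 (b p.1)) (η := fun p => slide p.1.2 (H (p.1.1, p.2)))
      ⟨continuous_slide.comp_continuousOn ((hp.cont_a.comp continuousOn_fst
          fun p hp => hp.1).prodMk continuousOn_snd),
        (continuous_slide.comp ((cb.comp continuous_fst).prodMk continuous_snd)).continuousOn,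
        continuous_slide.comp_continuousOn ((hp.cont_H.comp (by fun_prop)
          fun p hp => ⟨hp.1.1, trivial⟩).prodMk (by fun_prop)),
        fun p hz => by simp only [hp.H_zero _ hz.1, slide_map],
        fun p hz => by simp only [hp.H_one _ hz.1]⟩
      (by
        simp only [slide_one]
        refine ⟨fun z => incl (a' z), fun p => incl (H' p),
          ⟨continuous_incl.comp_continuousOn hp'.cont_a,
            (continuous_incl.comp (continuous_shift.comp cb)).continuousOn,
            continuous_incl.comp_continuousOn hp'.cont_H, fun z hz => ?_, fun z hz => ?_⟩,
          fun z hz => congrArg incl (ea hz), fun p hp => congrArg incl (eH hp)⟩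
        · rw [hp'.H_zero z hz, incl_map]
        · rw [hp'.H_one z hz])
    simpa only [slide_zero] using this

/-- A map of mapping telescopes is a weak equivalence if it is one at each stage: cubes are compact,
so lifting problems on them have bounded height. -/
lemma isWeakEquiv_map (hα : ∀ k, IsWeakEquiv (α k)) : IsWeakEquiv (map α h) := by
  rw [isWeakEquiv_iff_help]
  intro k a b H hp
  have hbd : ∀ {W : Type} [TopologicalSpace W] {A : Set W} {Z : ℕ → PtCG.{u}}
      {e : ∀ k, Z k ⟶ Z (k + 1)} {φ : W → space Z e}, IsCompact A → ContinuousOn φ A →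
      ∃ N : ℕ, ∀ w ∈ A, height (φ w) ≤ N := by
    intro W _ A Z e φ hA hφ
    obtain ⟨C, hC⟩ := (hA.image_of_continuousOn
      (continuous_height.comp_continuousOn hφ)).bddAbove
    obtain ⟨N, hN⟩ := exists_nat_ge C
    exact ⟨N, fun w hw => (hC (mem_image_of_mem _ hw)).trans hN⟩
  have hB : IsCompact (Cube.boundary (Fin k)) := isClosed_boundary.isCompact
  obtain ⟨N₁, h₁⟩ := hbd hB hp.cont_a
  obtain ⟨N₂, h₂⟩ := hbd isCompact_univ hp.cont_b
  obtain ⟨N₃, h₃⟩ := hbd (hB.prod isCompact_univ) hp.cont_H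
  refine solvable_of_height_le k (N₁ + N₂ + N₃) hα hp (fun z hz => (h₁ z hz).trans ?_)
    (fun z => (h₂ z trivial).trans ?_) (fun p hp => (h₃ p hp).trans ?_) <;> norm_cast <;> omega

end Telescope

/-! ### Formal properties of weak equivalences -/

lemma IsWeakEquiv.comp {X Y Z : PtCG.{u}} {f : X ⟶ Y} {g : Y ⟶ Z} (hf : IsWeakEquiv f)
    (hg : IsWeakEquiv g) : IsWeakEquiv (f ≫ g) := fun k x => by
  have : piMap (f ≫ g).hom k x = piMap g.hom k (f x) ∘ piMap f.hom k x := by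
    funext p
    induction p using Quotient.inductionOn with | h p => rfl
  rw [this]
  exact (hg k (f x)).comp (hf k x)

lemma isWeakEquiv_of_isIso {X Y : PtCG.{u}} (f : X ⟶ Y) [IsIso f] : IsWeakEquiv f := fun k x => by
  have h1 : ∀ x, (inv f) (f x) = x := PtCG.congr_apply (IsIso.hom_inv_id f)
  have h2 : ∀ y, f ((inv f) y) = y := PtCG.congr_apply (IsIso.inv_hom_id f)
  constructor
  · intro p q hpq
    induction p using Quotient.inductionOn with | h p => ?_
    induction q using Quotient.inductionOn with | h q => ?_
    have h3 : (genLoopMap f.hom k x p).1.HomotopicRel (genLoopMap f.hom k x q).1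
      (Cube.boundary (Fin k)) := Quotient.exact hpq
    have h4 := h3.comp_continuousMap (inv f).hom
    have h5 : ∀ p : GenLoop (Fin k) X x,
        (inv f).hom.comp (genLoopMap f.hom k x p).1 = p.1 := fun p =>
      ContinuousMap.ext fun y => h1 (p y)
    rw [h5, h5] at h4
    exact Quotient.sound h4
  · intro q
    induction q using Quotient.inductionOn with | h q => ?_
    refine ⟨Quotient.mk _ ⟨(inv f).hom.comp q.1, fun y hy => ?_⟩, congrArg (Quotient.mk _) ?_⟩
    · exact (congrArg (inv f) (q.2 y hy)).trans (h1 x)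
    · exact Subtype.ext (ContinuousMap.ext fun y => h2 (q y))

/-! ### Smash products, joins and spheres -/

/-- The homeomorphism `X ∧ (U * Y) ≅ U * (X ∧ Y)`: smashing with `X` commutes with cones, as it does
with quotient maps and with products with `I`. -/
instance isIso_smashJoin {ι : Type} (X : Sp.{u}) (U : Finset ι) (Y : Sp.{u}) :
    IsIso ((smashJoin X U).app Y) := by
  let A := X.toPtCG
  let B := Y.toPtCG
  let c : U → PtCG.smash A B → I → PtCG.smash A (Join.space U B) := fun i z s =>
    PtCG.smashLift (fun x y => PtCG.smashMk x (Join.conePt i y s)) (PtCG.pt _)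
      (fun y => PtCG.smashMk_pt_left _)
      (fun x => by rw [Join.conePt_pt]; exact PtCG.smashMk_pt_right x) z
  have cc : ∀ i, Continuous fun p : PtCG.smash A B × I => c i p.1 p.2 := fun i => by
    have hq : IsQuotientMap (Quot.mk (PtCG.smashRel A B)) := isQuotientMap_quot_mk
    refine hq.continuous_lift_prod_left (g := fun p : PtCG.smash A B × I => c i p.1 p.2) ?_
    refine PtCG.continuous_smashMk.comp (continuous_toK (g := fun p : Kify (A × B) × I =>
      ((ofK p.1).1, (Join.conePt i (ofK p.1).2 p.2 : Join.space U B))) ?_)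
    have h := Join.continuous_conePt (U := U) (Y := B) i
    have h1 : Continuous fun p : Kify (A × B) × I => ofK p.1 := continuous_ofK.comp continuous_fst
    exact h1.fst.prodMk (h.comp (h1.snd.prodMk continuous_snd))
  let b : PtCG.smash A B ⟶ PtCG.smash A (Join.space U B) :=
    PtCG.smashMap A (PtCG.mkHom Join.inlPt Join.continuous_inlPt rfl)
  let g : Join.space U (PtCG.smash A B) ⟶ PtCG.smash A (Join.space U B) :=
    PtCG.mkHom (Join.lift b c
      (fun i z => by
        induction z using PtCG.smash_ind with
        | h x y => exact congrArg (PtCG.smashMk x) (Join.conePt_zero i y))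
      (fun i z => by
        rw [PtCG.apply_pt b]
        induction z using PtCG.smash_ind with
        | h x y =>
          exact (congrArg (PtCG.smashMk x) (Join.conePt_one i y)).trans (PtCG.smashMk_pt_right x))
      (fun i s => (PtCG.smashMk_pt_left _).trans (PtCG.apply_pt b).symm))
      (Join.continuous_lift (PtCG.hom_continuous b) cc) (PtCG.apply_pt b)
  refine ⟨⟨g, PtCG.hom_ext fun z => ?_, PtCG.hom_ext fun z => ?_⟩⟩
  · induction z using PtCG.smash_ind with
    | h x w =>
      induction w using Join.ind with
      | hl y => rfl
      | hc i y s => rfl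
  · induction z using Join.ind with
    | hl w =>
      induction w using PtCG.smash_ind with
      | h x y => rfl
    | hc i w s =>
      induction w using PtCG.smash_ind with
      | h x y => rfl

instance isIso_smashSphere (X : Sp.{u}) : IsIso (smashSphere X) := by
  let A := X.toPtCG
  let B : PtCG.{u} := (finSp 1).toPtCG
  let i₁ : B := (⟨1⟩ : ULift (Fin 2))
  have hc : Continuous fun x : A => (toK (x, i₁) : Kify (A × B)) :=
    continuous_toK (continuous_id.prodMk continuous_const)
  let g : A ⟶ PtCG.smash A B := PtCG.mkHom (fun x => PtCG.smashMk x i₁)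
    (PtCG.continuous_smashMk.comp hc) (PtCG.smashMk_pt_left _)
  refine ⟨⟨g, PtCG.hom_ext fun z => ?_, PtCG.hom_ext fun x => ?_⟩⟩
  · induction z using PtCG.smash_ind with
    | h x i =>
      obtain ⟨i⟩ : ULift (Fin 2) := i
      change PtCG.smashMk (if (⟨i⟩ : ULift (Fin 2)) = ⟨0⟩ then A.pt else x) i₁ =
        (PtCG.smashMk x ⟨i⟩ : PtCG.smash A B)
      fin_cases i
      · exact (PtCG.smashMk_pt_left _).trans (PtCG.smashMk_pt_right (Y := B) x).symm
      · rfl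
  · rfl

/-! ### Goodwillie's construction preserves weak equivalences -/

variable {F G : Sp.{u} ⥤ PtCG.{u}}

lemma isWeakEquiv_TiterMap (n : ℕ) {α : F ⟶ G} (h : ∀ Y, IsWeakEquiv (α.app Y)) (k : ℕ) :
    ∀ Y, IsWeakEquiv ((TiterMap n α k).app Y) := by
  induction k with
  | zero => exact h
  | succ k ih => exact fun Y => isWeakEquiv_holimMap _ fun U => ih _

lemma isWeakEquiv_Pmap (n : ℕ) {α : F ⟶ G} (h : ∀ Y, IsWeakEquiv (α.app Y)) (Y : Sp.{u}) :
    IsWeakEquiv ((Pmap n α).app Y) :=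
  Telescope.isWeakEquiv_map fun k => isWeakEquiv_TiterMap n h k Y

lemma isWeakEquiv_shiftTiter (n : ℕ) (X : Sp.{u}) (F : Sp.{u} ⥤ PtCG.{u}) (k : ℕ) :
    ∀ Y, IsWeakEquiv ((shiftTiter n X F k).app Y) := by
  induction k with
  | zero => exact fun Y => isWeakEquiv_of_isIso (𝟙 _)
  | succ k ih =>
    intro Y
    have h1 : IsWeakEquiv ((Tmap n (shiftTiter n X F k)).app Y) :=
      isWeakEquiv_holimMap _ fun U => ih _
    have h2 : IsWeakEquiv ((shiftT n X (Titer n F k)).app Y) :=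
      isWeakEquiv_holimMap _ fun U =>
        isWeakEquiv_of_isIso ((Titer n F k).map ((smashJoin X U.1).app Y))
    exact h1.comp h2

lemma isWeakEquiv_shiftP (n : ℕ) (X : Sp.{u}) (F : Sp.{u} ⥤ PtCG.{u}) (Y : Sp.{u}) :
    IsWeakEquiv ((shiftP n X F).app Y) :=
  Telescope.isWeakEquiv_map fun k => isWeakEquiv_shiftTiter n X F k Y

lemma isWeakEquiv_map_smashSphere (F : Sp.{u} ⥤ PtCG.{u}) (X : Sp.{u}) :
    IsWeakEquiv (F.map (smashSphere X)) :=
  isWeakEquiv_of_isIso _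

end AlgGoodwillie

/-- If `F` is a continuous functor from spaces to spaces and `F_X` commutes with realizations, that
is, the natural map `L F_X (Y) ⟶ F_X (Y)` is a weak equivalence for all spaces `Y`, then the natural
map `P_n^alg F(X) ⟶ P_n F(X)` is a weak equivalence. -/
theorem mainTheorem7 (F : AlgGoodwillie.Sp.{u} ⥤ AlgGoodwillie.Sp.{u})
    (hF : AlgGoodwillie.IsContinuousFunctor (F ⋙ AlgGoodwillie.Sp.forget))
    (n : ℕ) (X : AlgGoodwillie.Sp.{u})
    (hX : ∀ Y : AlgGoodwillie.Sp.{u}, AlgGoodwillie.IsWeakEquiv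
      ((AlgGoodwillie.leftKanCounit (AlgGoodwillie.shift X (F ⋙ AlgGoodwillie.Sp.forget))
        (hF.shift X)).app Y)) :
    AlgGoodwillie.IsWeakEquiv
      (AlgGoodwillie.palgToP n (F ⋙ AlgGoodwillie.Sp.forget) hF X) :=
  (AlgGoodwillie.isWeakEquiv_Pmap n hX AlgGoodwillie.sphereZero).comp
    ((AlgGoodwillie.isWeakEquiv_shiftP n X _ AlgGoodwillie.sphereZero).comp
      (AlgGoodwillie.isWeakEquiv_map_smashSphere _ X))
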